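/- Let $k$ be a field and let $A$ be a finite-dimensional (associative, unital) $k$-algebra whose Jacobson radical $r$ satisfies $r^2=0$. Write $A/r=\bigoplus_{i\in\Delta_0}\overline A_i$ as a finite direct sum of simple $k$-algebras (such a decomposition exists; fix any one), and put $\mathcal A=\{\overline A_i\}_{i\in\Delta_0}$. Since $r^2=0$, $r$ is an $A/r$-bimodule. Let $\Delta$ be the quiver of $A$: its vertex set is $\Delta_0$, and the number of arrows from $i$ to $j$ is the rank of the $\overline A_i$-$\overline A_j$-bimodule $\overline A_i\cdot r\cdot\overline A_j$, that is, the least cardinality of a generating set of this bimodule. Let $k(\Delta,\mathcal A)$ be the generalized path algebra: the quotient of the $k$-vector space with basis all $\mathcal A$-paths, i.e. all elements $a\in\overline A_i$ ($i\in\Delta_0$; length $0$, start and end vertex $i$) and all words $a_1\beta_1a_2\beta_2\cdots a_n\beta_na_{n+1}$ with $n\ge1$, $\beta_1\cdots\beta_n$ a path of $\Delta$, $a_m$ in the algebra at the start vertex of $\beta_m$ for $m\le n$, and $a_{n+1}$ in the algebra at the end vertex of $\beta_n$ (length $n$), by the subspace that makes these symbols $k$-linear in each entry $a_m$; the product of two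 $\mathcal A$-paths is $(\cdots\beta_na_{n+1})\cdot(b_1\gamma_1\cdots)=\cdots\beta_n(a_{n+1}b_1)\gamma_1\cdots$ if the end vertex of the first is the start vertex of the second, and $0$ otherwise. Let $\widetilde J$ be the two-sided ideal of $k(\Delta,\mathcal A)$ generated by all $\mathcal A$-paths of length $1$. A relation is a $k$-linear combination of $\mathcal A$-paths with a common start vertex and a common end vertex; for a set $\rho$ of relations let $\langle\rho\rangle$ be the two-sided ideal it generates and $k(\Delta,\mathcal A,\rho)=k(\Delta,\mathcal A)/\langle\rho\rangle$. Suppose that one of the following conditions holds: (i) $\operatorname{Dim}A/r\le1$, where $\operatorname{Dim}B=\sup\{n: H^n_k(B,M)\ne0\text{ for some }B\text{-bimodule }M\}$ and $H^n_k(B,M)$ is Hochschild cohomology; (ii) $A/r$ is a separable $k$-algebra (i.e. projective as a bimodule over itself); (iii) $k$ is a perfect field. Then there is a set $\rho$ of relations of $k(\Delta,\mathcal A)$ such that $\widetilde J^{2}\subseteq\langle\rho\rangle\subseteq\widetilde J$ and $A\cong k(\Delta,\mathcal A,\rho)$ as $k$-algebras. -/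

import Mathlib

open scoped TensorProduct

/-! ### Generalized path algebras -/

namespace GenPath

universe u v w x

/-- The `𝒜`-paths from `i` to `j`: an element `a` of `𝒜 i` (length zero), or
`a₁ β₁ a₂ β₂ ⋯ aₙ βₙ aₙ₊₁` where `β₁ ⋯ βₙ` is a path of the quiver, each `aₘ` (`m ≤ n`) lies in the
algebra at the start vertex of `βₘ`, and `aₙ₊₁` lies in the algebra at the end vertex of `βₙ`. -/
inductive APath {V : Type v} (Q : Quiver.{w} V) (𝒜 : V → Type x) : V → V → Type (max v w x)
  | nil {i : V} (a : 𝒜 i) : APath Q 𝒜 i i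
  | cons {i j l : V} (a : 𝒜 i) (β : Q.Hom i j) (p : APath Q 𝒜 j l) : APath Q 𝒜 i l

namespace APath

variable {V : Type v} {Q : Quiver.{w} V} {𝒜 : V → Type x}

/-- The length of an `𝒜`-path: its number of arrows. -/
def length : ∀ {i j : V}, APath Q 𝒜 i j → ℕ
  | _, _, nil _ => 0
  | _, _, cons _ _ p => p.length + 1

variable [∀ i, Ring (𝒜 i)]

/-- The product of composable `𝒜`-paths: they are concatenated, and the last algebra element of the
first is multiplied with the first algebra element of the second. -/
def comp : ∀ {i j l : V}, APath Q 𝒜 i j → APath Q 𝒜 j l → APath Q 𝒜 i l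
  | _, _, _, nil a, nil b => nil (a * b)
  | _, _, _, nil a, cons b β q => cons (a * b) β q
  | _, _, _, cons a β p, q => cons a β (comp p q)

theorem comp_assoc {i j l m : V} (p : APath Q 𝒜 i j) (q : APath Q 𝒜 j l) (r : APath Q 𝒜 l m) :
    (p.comp q).comp r = p.comp (q.comp r) := by
  induction p with
  | nil a => cases q <;> cases r <;> simp [comp, mul_assoc]
  | cons a β p ih => simp [comp, ih]

theorem one_comp {i j : V} (p : APath Q 𝒜 i j) : (nil 1).comp p = p := by
  cases p <;> simp [comp]

theorem comp_one {i j : V} (p : APath Q 𝒜 i j) : p.comp (nil 1) = p := by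
  induction p with
  | nil a => simp [comp]
  | cons a β p ih => simp [comp, ih]

/-- `IsAdd p q r`: the paths agree except at one algebra entry, where `p` has `a + b`,
`q` has `a` and `r` has `b`. -/
inductive IsAdd : ∀ {i j : V}, APath Q 𝒜 i j → APath Q 𝒜 i j → APath Q 𝒜 i j → Prop
  | nil {i : V} (a b : 𝒜 i) : IsAdd (nil (a + b)) (nil a) (nil b)
  | head {i j l : V} (a b : 𝒜 i) (β : Q.Hom i j) (p : APath Q 𝒜 j l) :
      IsAdd (cons (a + b) β p) (cons a β p) (cons b β p)
  | tail {i j l : V} (a : 𝒜 i) (β : Q.Hom i j) {p q r : APath Q 𝒜 j l} :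
      IsAdd p q r → IsAdd (cons a β p) (cons a β q) (cons a β r)

/-- `IsSMul c p q`: the paths agree except at one algebra entry, where `p` has `c • a` and
`q` has `a`. -/
inductive IsSMul {k : Type u} [Field k] [∀ i, Algebra k (𝒜 i)] (c : k) :
    ∀ {i j : V}, APath Q 𝒜 i j → APath Q 𝒜 i j → Prop
  | nil {i : V} (a : 𝒜 i) : IsSMul c (nil (c • a)) (nil a)
  | head {i j l : V} (a : 𝒜 i) (β : Q.Hom i j) (p : APath Q 𝒜 j l) :
      IsSMul c (cons (c • a) β p) (cons a β p)
  | tail {i j l : V} (a : 𝒜 i) (β : Q.Hom i j) {p q : APath Q 𝒜 j l} :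
      IsSMul c p q → IsSMul c (cons a β p) (cons a β q)

theorem IsAdd.comp_right {i j l : V} {p q r : APath Q 𝒜 i j} (h : IsAdd p q r)
    (s : APath Q 𝒜 j l) : IsAdd (p.comp s) (q.comp s) (r.comp s) := by
  induction h with
  | nil a b => cases s <;> simp only [comp, add_mul] <;> constructor
  | head a b β p => exact .head a b β _
  | tail a β _ ih => exact .tail a β (ih s)

theorem IsAdd.comp_left {i j l : V} (s : APath Q 𝒜 i j) {p q r : APath Q 𝒜 j l}
    (h : IsAdd p q r) : IsAdd (s.comp p) (s.comp q) (s.comp r) := by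
  induction s with
  | nil a =>
    cases h with
    | nil b c => simp only [comp, mul_add]; constructor
    | head b c β p => simp only [comp, mul_add]; constructor
    | tail b β h => exact .tail _ β h
  | cons a β s ih => exact .tail a β (ih h)

theorem IsSMul.comp_right {k : Type u} [Field k] [∀ i, Algebra k (𝒜 i)] {c : k} {i j l : V}
    {p q : APath Q 𝒜 i j} (h : IsSMul c p q) (s : APath Q 𝒜 j l) :
    IsSMul c (p.comp s) (q.comp s) := by
  induction h with
  | nil a => cases s <;> simp only [comp, smul_mul_assoc] <;> constructor
  | head a β p => exact .head a β _
  | tail a β _ ih => exact .tail a β (ih s)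

theorem IsSMul.comp_left {k : Type u} [Field k] [∀ i, Algebra k (𝒜 i)] {c : k} {i j l : V}
    (s : APath Q 𝒜 i j) {p q : APath Q 𝒜 j l} (h : IsSMul c p q) :
    IsSMul c (s.comp p) (s.comp q) := by
  induction s with
  | nil a =>
    cases h with
    | nil b => simp only [comp, mul_smul_comm]; constructor
    | head b β p => simp only [comp, mul_smul_comm]; constructor
    | tail b β h => exact .tail _ β h
  | cons a β s ih => exact .tail a β (ih h)

end APath

section Algebra

variable (k : Type u) [Field k] {V : Type v} (Q : Quiver.{w} V) (𝒜 : V → Type x)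

/-- The `k`-linear space with basis the set of all `𝒜`-paths. -/
abbrev PathSpace := (Σ i j : V, APath Q 𝒜 i j) →₀ k

variable {Q 𝒜}

/-- The basis vector of an `𝒜`-path. -/
noncomputable def basisPath {i j : V} (p : APath Q 𝒜 i j) : PathSpace k Q 𝒜 :=
  Finsupp.single ⟨i, j, p⟩ 1

variable [∀ i, Ring (𝒜 i)]

open Classical in
/-- The product of two `𝒜`-paths in the path space: their composite if the end vertex of the first is
the start vertex of the second, and zero otherwise. -/
noncomputable def mulPaths :
    (Σ i j : V, APath Q 𝒜 i j) → (Σ i j : V, APath Q 𝒜 i j) → PathSpace k Q 𝒜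
  | ⟨_, j, p⟩, ⟨j', _, q⟩ => if h : j = j' then basisPath k (p.comp (h ▸ q)) else 0

theorem mulPaths_comp {i j l : V} (p : APath Q 𝒜 i j) (q : APath Q 𝒜 j l) :
    mulPaths k ⟨i, j, p⟩ ⟨j, l, q⟩ = basisPath k (p.comp q) := by
  simp [mulPaths]

theorem mulPaths_ne {i j j' l : V} (h : j ≠ j') (p : APath Q 𝒜 i j) (q : APath Q 𝒜 j' l) :
    mulPaths k ⟨i, j, p⟩ ⟨j', l, q⟩ = 0 := by
  simp [mulPaths, h]

variable (Q 𝒜) in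
/-- The bilinear extension of the product of paths. -/
noncomputable def mulPre : PathSpace k Q 𝒜 →ₗ[k] PathSpace k Q 𝒜 →ₗ[k] PathSpace k Q 𝒜 :=
  Finsupp.lift _ k _ fun P => Finsupp.lift _ k _ fun R => mulPaths k P R

theorem mulPre_basis {i j j' l : V} (p : APath Q 𝒜 i j) (q : APath Q 𝒜 j' l) :
    mulPre k Q 𝒜 (basisPath k p) (basisPath k q) = mulPaths k ⟨i, j, p⟩ ⟨j', l, q⟩ := by
  simp [mulPre, basisPath]

theorem span_basisPath :
    Submodule.span k {y : PathSpace k Q 𝒜 | ∃ (i j : V) (p : APath Q 𝒜 i j), y = basisPath k p}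
      = ⊤ := by
  refine eq_top_iff.2 fun y _ => ?_
  induction y using Finsupp.induction_linear with
  | zero => exact zero_mem _
  | add f g hf hg => exact add_mem (hf trivial) (hg trivial)
  | single P c =>
    obtain ⟨i, j, p⟩ := P
    have : Finsupp.single (⟨i, j, p⟩ : Σ i j : V, APath Q 𝒜 i j) c = c • basisPath k p := by
      simp [basisPath]
    rw [this]
    exact Submodule.smul_mem _ _ (Submodule.subset_span ⟨i, j, p, rfl⟩)

theorem hom_ext_basis {M : Type*} [AddCommGroup M] [Module k M] {f g : PathSpace k Q 𝒜 →ₗ[k] M}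
    (h : ∀ (i j : V) (p : APath Q 𝒜 i j), f (basisPath k p) = g (basisPath k p)) : f = g :=
  LinearMap.ext_on (span_basisPath k) (by rintro _ ⟨i, j, p, rfl⟩; exact h i j p)

theorem mulPre_assoc (y₁ y₂ y₃ : PathSpace k Q 𝒜) :
    mulPre k Q 𝒜 (mulPre k Q 𝒜 y₁ y₂) y₃ = mulPre k Q 𝒜 y₁ (mulPre k Q 𝒜 y₂ y₃) := by
  induction y₁ using Finsupp.induction_linear with
  | zero => simp
  | add f g hf hg => simp only [map_add, LinearMap.add_apply, hf, hg]
  | single P c =>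
  induction y₂ using Finsupp.induction_linear with
  | zero => simp
  | add f g hf hg => simp only [map_add, LinearMap.add_apply, hf, hg]
  | single R d =>
  induction y₃ using Finsupp.induction_linear with
  | zero => simp
  | add f g hf hg => simp only [map_add, hf, hg]
  | single T e =>
  obtain ⟨i, j, p⟩ := P
  obtain ⟨j', l, q⟩ := R
  obtain ⟨l', m, r⟩ := T
  have hs : ∀ {i j : V} (p : APath Q 𝒜 i j) (c : k),
      Finsupp.single (⟨i, j, p⟩ : Σ i j : V, APath Q 𝒜 i j) c = c • basisPath k p := by
    intro i j p c; simp [basisPath]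
  simp only [hs, map_smul, LinearMap.smul_apply, mulPre_basis]
  by_cases h₁ : j = j'
  · subst h₁
    by_cases h₂ : l = l'
    · subst h₂
      simp only [mulPaths_comp, mulPre_basis, APath.comp_assoc]
    · simp only [mulPaths_comp, mulPre_basis, mulPaths_ne k h₂, map_zero, smul_zero]
  · by_cases h₂ : l = l'
    · subst h₂
      simp only [mulPaths_comp, mulPre_basis, mulPaths_ne k h₁, map_zero, smul_zero,
        LinearMap.zero_apply]
    · simp only [mulPaths_ne k h₁, mulPaths_ne k h₂, map_zero, smul_zero, LinearMap.zero_apply]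

variable [∀ i, Algebra k (𝒜 i)]

variable (Q 𝒜) in
/-- The subspace generated by the elements that express `k`-linearity in every algebra entry of an
`𝒜`-path. -/
noncomputable def linRel : Submodule k (PathSpace k Q 𝒜) :=
  Submodule.span k
    ({y | ∃ (i j : V) (p q r : APath Q 𝒜 i j), APath.IsAdd p q r ∧
        y = basisPath k p - (basisPath k q + basisPath k r)} ∪
     {y | ∃ (i j : V) (c : k) (p q : APath Q 𝒜 i j), APath.IsSMul c p q ∧
        y = basisPath k p - c • basisPath k q})

theorem linRel_mul_right (y z : PathSpace k Q 𝒜) (hy : y ∈ linRel k Q 𝒜) :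
    mulPre k Q 𝒜 y z ∈ linRel k Q 𝒜 := by
  have hz : z ∈ Submodule.span k
      {y : PathSpace k Q 𝒜 | ∃ (i j : V) (p : APath Q 𝒜 i j), y = basisPath k p} := by
    rw [span_basisPath]; trivial
  induction hz using Submodule.span_induction with
  | zero => simp
  | add a b _ _ ha hb => rw [map_add]; exact add_mem ha hb
  | smul c a _ ha => rw [map_smul]; exact Submodule.smul_mem _ _ ha
  | mem z hz =>
  obtain ⟨i', l, s, rfl⟩ := hz
  induction hy using Submodule.span_induction with
  | zero => simp
  | add a b _ _ ha hb => rw [map_add, LinearMap.add_apply]; exact add_mem ha hb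
  | smul c a _ ha => rw [map_smul, LinearMap.smul_apply]; exact Submodule.smul_mem _ _ ha
  | mem y hy =>
  rcases hy with ⟨i, j, p, q, r, h, rfl⟩ | ⟨i, j, c, p, q, h, rfl⟩ <;>
    simp only [map_sub, map_add, map_smul, LinearMap.sub_apply, LinearMap.add_apply,
      LinearMap.smul_apply, mulPre_basis]
  · by_cases hj : j = i'
    · subst hj
      simp only [mulPaths_comp]
      exact Submodule.subset_span (.inl ⟨_, _, _, _, _, h.comp_right s, rfl⟩)
    · simp [mulPaths_ne k hj]
  · by_cases hj : j = i'
    · subst hj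
      simp only [mulPaths_comp]
      exact Submodule.subset_span (.inr ⟨_, _, _, _, _, h.comp_right s, rfl⟩)
    · simp [mulPaths_ne k hj]

theorem linRel_mul_left (z y : PathSpace k Q 𝒜) (hy : y ∈ linRel k Q 𝒜) :
    mulPre k Q 𝒜 z y ∈ linRel k Q 𝒜 := by
  have hz : z ∈ Submodule.span k
      {y : PathSpace k Q 𝒜 | ∃ (i j : V) (p : APath Q 𝒜 i j), y = basisPath k p} := by
    rw [span_basisPath]; trivial
  induction hz using Submodule.span_induction with
  | zero => simp
  | add a b _ _ ha hb => rw [map_add, LinearMap.add_apply]; exact add_mem ha hb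
  | smul c a _ ha => rw [map_smul, LinearMap.smul_apply]; exact Submodule.smul_mem _ _ ha
  | mem z hz =>
  obtain ⟨l, i', s, rfl⟩ := hz
  induction hy using Submodule.span_induction with
  | zero => simp
  | add a b _ _ ha hb => rw [map_add]; exact add_mem ha hb
  | smul c a _ ha => rw [map_smul]; exact Submodule.smul_mem _ _ ha
  | mem y hy =>
  rcases hy with ⟨i, j, p, q, r, h, rfl⟩ | ⟨i, j, c, p, q, h, rfl⟩ <;>
    simp only [map_sub, map_add, map_smul, mulPre_basis]
  · by_cases hj : i' = i
    · subst hj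
      simp only [mulPaths_comp]
      exact Submodule.subset_span (.inl ⟨_, _, _, _, _, h.comp_left s, rfl⟩)
    · simp [mulPaths_ne k hj]
  · by_cases hj : i' = i
    · subst hj
      simp only [mulPaths_comp]
      exact Submodule.subset_span (.inr ⟨_, _, _, _, _, h.comp_left s, rfl⟩)
    · simp [mulPaths_ne k hj]

variable (Q 𝒜) in
/-- The generalized path algebra (`𝒜`-path algebra) `k(Δ, 𝒜)` of the quiver `Q`: the space of
`𝒜`-paths modulo linearity in every algebra entry. -/
def GenPathAlgebra : Type (max u v w x) := PathSpace k Q 𝒜 ⧸ linRel k Q 𝒜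

namespace GenPathAlgebra

noncomputable instance : AddCommGroup (GenPathAlgebra k Q 𝒜) :=
  inferInstanceAs (AddCommGroup (PathSpace k Q 𝒜 ⧸ linRel k Q 𝒜))

noncomputable instance : Module k (GenPathAlgebra k Q 𝒜) :=
  inferInstanceAs (Module k (PathSpace k Q 𝒜 ⧸ linRel k Q 𝒜))

variable (Q 𝒜) in
/-- The quotient map. -/
noncomputable def mk : PathSpace k Q 𝒜 →ₗ[k] GenPathAlgebra k Q 𝒜 := (linRel k Q 𝒜).mkQ

theorem mk_surjective : Function.Surjective (mk k Q 𝒜) := Submodule.mkQ_surjective _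

theorem mk_eq_zero {y : PathSpace k Q 𝒜} (h : y ∈ linRel k Q 𝒜) : mk k Q 𝒜 y = 0 :=
  (Submodule.Quotient.mk_eq_zero _).2 h

/-- The class `[p]` of an `𝒜`-path. -/
noncomputable def ofPath {i j : V} (p : APath Q 𝒜 i j) : GenPathAlgebra k Q 𝒜 :=
  mk k Q 𝒜 (basisPath k p)

variable (Q 𝒜) in
/-- The multiplication of the generalized path algebra, induced by the product of paths. -/
noncomputable def mulMap :
    GenPathAlgebra k Q 𝒜 →ₗ[k] GenPathAlgebra k Q 𝒜 →ₗ[k] GenPathAlgebra k Q 𝒜 :=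
  LinearMap.liftQ₂ (linRel k Q 𝒜) (linRel k Q 𝒜) ((mulPre k Q 𝒜).compr₂ (mk k Q 𝒜))
    (fun y hy => LinearMap.mem_ker.2 (LinearMap.ext fun z =>
      mk_eq_zero k (linRel_mul_right k y z hy)))
    (fun y hy => LinearMap.mem_ker.2 (LinearMap.ext fun z =>
      mk_eq_zero k (linRel_mul_left k z y hy)))

theorem mulMap_mk (y z : PathSpace k Q 𝒜) :
    mulMap k Q 𝒜 (mk k Q 𝒜 y) (mk k Q 𝒜 z) = mk k Q 𝒜 (mulPre k Q 𝒜 y z) := rfl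

variable [Fintype V]

variable (Q 𝒜) in
/-- The sum of the identities `eᵢ` of the algebras `𝒜 i`. -/
noncomputable def onePre : PathSpace k Q 𝒜 := ∑ i : V, basisPath k (APath.nil (1 : 𝒜 i))

theorem onePre_mul (y : PathSpace k Q 𝒜) : mulPre k Q 𝒜 (onePre k Q 𝒜) y = y := by
  have : mulPre k Q 𝒜 (onePre k Q 𝒜) = LinearMap.id := hom_ext_basis k fun i j p => by
    rw [onePre, map_sum, LinearMap.sum_apply, Finset.sum_eq_single i]
    · rw [mulPre_basis, mulPaths_comp, APath.one_comp]; rfl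
    · intro l _ hl
      rw [mulPre_basis, mulPaths_ne k hl]
    · exact fun h => absurd (Finset.mem_univ i) h
  rw [this]; rfl

theorem mul_onePre (y : PathSpace k Q 𝒜) : mulPre k Q 𝒜 y (onePre k Q 𝒜) = y := by
  have : (mulPre k Q 𝒜).flip (onePre k Q 𝒜) = LinearMap.id := hom_ext_basis k fun i j p => by
    rw [LinearMap.flip_apply, onePre, map_sum, Finset.sum_eq_single j]
    · rw [mulPre_basis, mulPaths_comp, APath.comp_one]; rfl
    · intro l _ hl
      rw [mulPre_basis, mulPaths_ne k (Ne.symm hl)]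
    · exact fun h => absurd (Finset.mem_univ j) h
  exact LinearMap.congr_fun this y

noncomputable instance : Ring (GenPathAlgebra k Q 𝒜) :=
  { (inferInstance : AddCommGroup (GenPathAlgebra k Q 𝒜)) with
    mul := fun y z => mulMap k Q 𝒜 y z
    one := mk k Q 𝒜 (onePre k Q 𝒜)
    left_distrib := fun y z t => map_add (mulMap k Q 𝒜 y) z t
    right_distrib := fun y z t => LinearMap.map_add₂ (mulMap k Q 𝒜) y z t
    zero_mul := fun y => LinearMap.map_zero₂ (mulMap k Q 𝒜) y
    mul_zero := fun y => map_zero (mulMap k Q 𝒜 y)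
    mul_assoc := fun y z t => by
      obtain ⟨y, rfl⟩ := mk_surjective k y
      obtain ⟨z, rfl⟩ := mk_surjective k z
      obtain ⟨t, rfl⟩ := mk_surjective k t
      exact congrArg (mk k Q 𝒜) (mulPre_assoc k y z t)
    one_mul := fun y => by
      obtain ⟨y, rfl⟩ := mk_surjective k y
      exact congrArg (mk k Q 𝒜) (onePre_mul k y)
    mul_one := fun y => by
      obtain ⟨y, rfl⟩ := mk_surjective k y
      exact congrArg (mk k Q 𝒜) (mul_onePre k y) }

noncomputable instance : Algebra k (GenPathAlgebra k Q 𝒜) :=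
  Algebra.ofModule (fun c y z => LinearMap.map_smul₂ (mulMap k Q 𝒜) c y z)
    (fun c y z => map_smul (mulMap k Q 𝒜 y) c z)

variable (Q 𝒜) in
/-- The ideal generated by all `𝒜`-paths of length one. -/
noncomputable def arrowIdeal : TwoSidedIdeal (GenPathAlgebra k Q 𝒜) :=
  TwoSidedIdeal.span {y | ∃ (i j : V) (p : APath Q 𝒜 i j), p.length = 1 ∧ y = ofPath k p}

/-- A relation: a `k`-linear combination of `𝒜`-paths with the same start vertex and the same end
vertex. -/
def IsRelation (σ : GenPathAlgebra k Q 𝒜) : Prop :=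
  ∃ i j : V, σ ∈ Submodule.span k (Set.range fun p : APath Q 𝒜 i j => ofPath k p)

end GenPathAlgebra

end Algebra

end GenPath

/-! ### Hochschild cohomology, the dimension of an algebra, separability -/

namespace Hochschild

universe u v w

variable (k : Type u) [Field k] (B : Type v) [Ring B] [Algebra k B]
  (M : Type w) [AddCommGroup M] [Module k M] [Module B M] [Module Bᵐᵒᵖ M]
  [SMulCommClass B Bᵐᵒᵖ M] [IsScalarTower k B M] [IsScalarTower k Bᵐᵒᵖ M]

/-- The Hochschild `n`-cochains: `k`-multilinear maps `Bⁿ → M`. -/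
abbrev Cochain (n : ℕ) := MultilinearMap k (fun _ : Fin n => B) M

variable {B M} in
/-- The Hochschild differential
`(df)(b₀, …, bₙ) = b₀ f(b₁, …, bₙ) + ∑ i < n, (-1)ⁱ⁺¹ f(…, bᵢ bᵢ₊₁, …) + (-1)ⁿ⁺¹ f(b₀, …, bₙ₋₁) bₙ`
as a function of `(b₀, …, bₙ)`. -/
def dFun {n : ℕ} (f : (Fin n → B) → M) (b : Fin (n + 1) → B) : M :=
  b 0 • f (Fin.tail b)
    + ∑ i : Fin n, (-1 : ℤ) ^ ((i : ℕ) + 1) • f (Fin.contractNth i.castSucc (· * ·) b)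
    + (-1 : ℤ) ^ (n + 1) • MulOpposite.op (b (Fin.last n)) • f (Fin.init b)

/-- The Hochschild differential as a `k`-linear map (with values in all functions). -/
def d (n : ℕ) : Cochain k B M n →ₗ[k] ((Fin (n + 1) → B) → M) where
  toFun f := dFun f
  map_add' f g := by
    funext b
    simp only [dFun, add_apply, smul_add, Finset.sum_add_distrib, Pi.add_apply]
    abel
  map_smul' c f := by
    have := IsScalarTower.to_smulCommClass (R := k) (A := B) (M := M)
    have := IsScalarTower.to_smulCommClass (R := k) (A := Bᵐᵒᵖ) (M := M)
    funext b
    simp only [dFun, smul_apply, Pi.smul_apply, smul_add, Finset.smul_sum,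
      RingHom.id_apply, smul_comm c]

/-- The Hochschild `n`-cocycles. -/
def cocycles (n : ℕ) : Submodule k (Cochain k B M n) := LinearMap.ker (d k B M n)

/-- The Hochschild `n`-coboundaries: the cochains of the form `dg`. -/
def coboundaries : (n : ℕ) → Submodule k (Cochain k B M n)
  | 0 => ⊥
  | n + 1 => (LinearMap.range (d k B M n)).comap
      ({ toFun := fun f => ⇑f, map_add' := fun _ _ => rfl, map_smul' := fun _ _ => rfl } :
        Cochain k B M (n + 1) →ₗ[k] ((Fin (n + 1) → B) → M))

/-- The Hochschild cohomology `Hⁿ(B, M)`. -/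
abbrev HH (n : ℕ) := cocycles k B M n ⧸ (coboundaries k B M n).comap (cocycles k B M n).subtype

/-- `Hⁿ(B, M) ≠ 0` for some `B`-bimodule `M` (over `k`). -/
def HasNonzero (n : ℕ) : Prop :=
  ∃ (M : Type v) (_ : AddCommGroup M) (_ : Module k M) (_ : Module B M) (_ : Module Bᵐᵒᵖ M)
    (_ : SMulCommClass B Bᵐᵒᵖ M) (_ : IsScalarTower k B M) (_ : IsScalarTower k Bᵐᵒᵖ M),
    Nontrivial (HH k B M n)

/-- `Dim B = sup {n : Hⁿ(B, M) ≠ 0 for some B-bimodule M}`. -/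
noncomputable def dim : ℕ∞ := sSup {m : ℕ∞ | ∃ n : ℕ, HasNonzero k B n ∧ m = n}

/-- A `k`-algebra `B` is separable if it is projective as a `B`-bimodule, that is, as a module over
`B ⊗ Bᵒᵖ`, where `a ⊗ b` acts on `B` as `x ↦ a x b`. -/
def IsSeparableAlgebra : Prop :=
  letI : Module (B ⊗[k] Bᵐᵒᵖ) B := TensorProduct.Algebra.module
  Module.Projective (B ⊗[k] Bᵐᵒᵖ) B

end Hochschild

/-! ### The quiver of an algebra with radical of square zero -/

universe u v

/-- A decomposition of a `k`-algebra `B` into a finite direct sum of simple `k`-algebras. -/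
structure SimpleDecomposition (k : Type u) [Field k] (B : Type v) [Ring B] [Algebra k B] where
  /-- the index set -/
  ι : Type
  [fintype : Fintype ι]
  /-- the simple summands -/
  comp : ι → Type v
  [ring : ∀ i, Ring (comp i)]
  [algebra : ∀ i, Algebra k (comp i)]
  [simple : ∀ i, IsSimpleRing (comp i)]
  /-- the identification with the direct sum -/
  equiv : B ≃ₐ[k] (∀ i, comp i)

namespace SimpleDecomposition

attribute [instance] fintype ring algebra simple

variable {k : Type u} [Field k] {A : Type v} [Ring A] [Algebra k A]

/-- The elements of `A` whose class in `A/r` lies in the `i`-th simple summand `Āᵢ`. -/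
def lift (D : SimpleDecomposition k (A ⧸ Ring.jacobson A)) (i : D.ι) : Submodule k A where
  carrier := {a | ∀ j, j ≠ i → D.equiv (Ideal.Quotient.mk (Ring.jacobson A) a) j = 0}
  add_mem' ha hb j hj := by simp [ha j hj, hb j hj]
  zero_mem' j _ := by simp
  smul_mem' c a ha j hj := by
    have h : Ideal.Quotient.mk (Ring.jacobson A) (c • a)
        = c • Ideal.Quotient.mk (Ring.jacobson A) a := rfl
    rw [h, map_smul, Pi.smul_apply, ha j hj, smul_zero]

/-- The bimodule `ᵢMⱼ = Āᵢ · r · Āⱼ`. When `r² = 0`, the class of `a` in `A/r` acts on `r` as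
multiplication by `a`. -/
def bimodule (D : SimpleDecomposition k (A ⧸ Ring.jacobson A)) (i j : D.ι) : Submodule k A :=
  D.lift i * (Ring.jacobson A).restrictScalars k * D.lift j

/-- `X` generates `ᵢMⱼ` as an `Āᵢ`-`Āⱼ`-bimodule: `X ⊆ ᵢMⱼ`, and the sums of elements `a x b` with
`a ∈ Āᵢ`, `x ∈ X`, `b ∈ Āⱼ` fill `ᵢMⱼ`. -/
def Generates (D : SimpleDecomposition k (A ⧸ Ring.jacobson A)) (i j : D.ι) (X : Finset A) : Prop :=
  (X : Set A) ⊆ D.bimodule i j ∧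
    D.lift i * Submodule.span k (X : Set A) * D.lift j = D.bimodule i j

/-- The rank of `ᵢMⱼ`: the least number of elements of a generating set. -/
noncomputable def rank (D : SimpleDecomposition k (A ⧸ Ring.jacobson A)) (i j : D.ι) : ℕ :=
  sInf {n | ∃ X : Finset A, D.Generates i j X ∧ X.card = n}

/-- The quiver of `A` when `r² = 0`: its vertices are the simple summands of `A/r`, and the number
of arrows from `i` to `j` is the rank of `ᵢMⱼ`. -/
@[reducible] noncomputable def quiver (D : SimpleDecomposition k (A ⧸ Ring.jacobson A)) : Quiver.{0} D.ι :=
  ⟨fun i j => Fin (D.rank i j)⟩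

end SimpleDecomposition

/-! The proof rests on Wedderburn's principal theorem for a radical of square zero: under each of
the three conditions the projection A → A/r ≅ ∏ Āᵢ has an algebra section σ
(`SimpleDecomposition.exists_section`). A linear section s fails to be multiplicative by a 2-cocycle
with values in r. If this cocycle is a coboundary dg, then s - g is multiplicative, because r² = 0
removes the quadratic term (`exists_algHom_section_of_coboundary`). Condition (i) gives g through H²
= 0. Under (ii) a separability element gives g by an explicit formula. Under (iii) a separability
element is built for each simple summand from one over its centre Z and one of Z over k, and these
are added up.

Given σ, evaluate the algebra entries of an 𝒜-path by σ and the arrows i → j by the members of a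
least generating set of ᵢMⱼ. This is an algebra homomorphism k(Δ, 𝒜) → A (`GenPathAlgebra.eval`). It
is onto, since its image contains σ(∏ Āᵢ) and every ᵢMⱼ, and r is the sum of the ᵢMⱼ. Followed by A
→ A/r it kills J̃ and is the identity on paths of length zero, so its kernel lies in J̃. It maps J̃²
into r² = 0, so the kernel contains J̃². Every two-sided ideal is generated by the relations in it
(`span_isRelation_mem`), so ρ can be the set of all relations in the kernel. -/

/-! ### Splitting square-zero extensions by separability elements. -/

section Splitting

variable {k : Type*} [Field k] {A B : Type*} [Ring A] [Algebra k A] [Ring B] [Algebra k B]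

/-- A linear section whose defect of multiplicativity is a coboundary can be corrected to an algebra
section, when the kernel has square zero. -/
theorem exists_algHom_section_of_coboundary (π : A →ₐ[k] B)
    (hker : ∀ x y, π x = 0 → π y = 0 → x * y = 0) (s g : B →ₗ[k] A) (hs : ∀ b, π (s b) = b)
    (hg : ∀ b, π (g b) = 0)
    (h : ∀ a b, s a * s b - s (a * b) = s a * g b - g (a * b) + g a * s b) :
    ∃ σ : B →ₐ[k] A, ∀ b, π (σ b) = b := by
  have hπ : ∀ b, π ((s - g) b) = b := fun b => by simp [hs, hg]
  have hmul : ∀ a b, (s - g) (a * b) = (s - g) a * (s - g) b := fun a b => by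
    have h1 := h a b
    have h2 := hker _ _ (hg a) (hg b)
    simp only [LinearMap.sub_apply, sub_mul, mul_sub, h2, sub_eq_iff_eq_add.1 h1]
    abel
  refine ⟨AlgHom.ofLinearMap (s - g) ?_ hmul, hπ⟩
  -- Multiplicativity makes `e`, hence `1 - e`, idempotent. As `e` lifts 1, `1 - e` lies in the
  -- kernel and squares to zero, so it vanishes.
  set e := (s - g) 1 with he
  have h1 : e * e = e := by rw [he, ← hmul, one_mul]
  have h2 : (1 - e) * (1 - e) = 0 := hker _ _ (by rw [map_sub, he, hπ, map_one, sub_self])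
    (by rw [map_sub, he, hπ, map_one, sub_self])
  have h3 : (1 - e) * (1 - e) = 1 - e := by simp [mul_sub, sub_mul, h1]
  rw [h3] at h2
  exact (sub_eq_zero.1 h2).symm

/-- A separability element: `e • 1 = 1` and `b ⊗ 1`, `1 ⊗ b` have the same product with `e`. -/
structure IsSeparabilityElement (k : Type*) [Field k] {B : Type*} [Ring B] [Algebra k B]
    (e : B ⊗[k] Bᵐᵒᵖ) : Prop where
  apply_one : AlgHom.mulLeftRight k B e 1 = 1
  tmul_one_mul : ∀ b : B, (b ⊗ₜ[k] (1 : Bᵐᵒᵖ)) * e = ((1 : B) ⊗ₜ[k] MulOpposite.op b) * e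

/-- The bimodule map t ↦ t • 1 onto B splits by projectivity; the image of 1 under the splitting is
the element. -/
theorem Hochschild.IsSeparableAlgebra.exists_isSeparabilityElement
    (h : Hochschild.IsSeparableAlgebra k B) :
    ∃ e : B ⊗[k] Bᵐᵒᵖ, IsSeparabilityElement k e := by
  let _ : Module (B ⊗[k] Bᵐᵒᵖ) B := TensorProduct.Algebra.module
  have hP : Module.Projective (B ⊗[k] Bᵐᵒᵖ) B := h
  have hsmul : ∀ (t : B ⊗[k] Bᵐᵒᵖ) (x : B), t • x = AlgHom.mulLeftRight k B t x :=
    fun t x => rfl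
  obtain ⟨σ, hσ⟩ := Module.projective_lifting_property
    (LinearMap.toSpanSingleton (B ⊗[k] Bᵐᵒᵖ) B 1) LinearMap.id (fun b =>
      ⟨b ⊗ₜ 1, by simp [hsmul]⟩)
  refine ⟨σ 1, ?_, fun b => ?_⟩
  · have := LinearMap.congr_fun hσ 1
    simpa [hsmul] using this
  · rw [← smul_eq_mul, ← smul_eq_mul, ← map_smul, ← map_smul]
    simp [hsmul]

/-- Let f be the defect of a linear section s. For e = ∑ xᵢ ⊗ yᵢ, the cochain g(b) = ∑ s(xᵢ) f(yᵢ,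
b) has coboundary f. This follows by evaluating s(a) g(b) in two ways, moving a across e. -/
theorem IsSeparabilityElement.exists_algHom_section {e : B ⊗[k] Bᵐᵒᵖ}
    (he : IsSeparabilityElement k e) (π : A →ₐ[k] B) (hsurj : Function.Surjective π)
    (hker : ∀ x y, π x = 0 → π y = 0 → x * y = 0) :
    ∃ σ : B →ₐ[k] A, ∀ b, π (σ b) = b := by
  obtain ⟨s, hs'⟩ := π.toLinearMap.exists_rightInverse_of_surjective
    (LinearMap.range_eq_top.2 hsurj)
  have hs : ∀ b, π (s b) = b := fun b => LinearMap.congr_fun hs' b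
  let f : B →ₗ[k] B →ₗ[k] A := (LinearMap.mul k A).compl₁₂ s s - (LinearMap.mul k B).compr₂ s
  have hf : ∀ a b, f a b = s a * s b - s (a * b) := fun a b => rfl
  have hπf : ∀ a b, π (f a b) = 0 := fun a b => by simp [hf, hs]
  let op' : Bᵐᵒᵖ →ₗ[k] B := (MulOpposite.opLinearEquiv k).symm.toLinearMap
  let T : B ⊗[k] Bᵐᵒᵖ →ₗ[k] A := TensorProduct.lift ((LinearMap.mul k A).compl₁₂ s (s ∘ₗ op'))
  let G : B →ₗ[k] B ⊗[k] Bᵐᵒᵖ →ₗ[k] A :=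
    { toFun := fun b => TensorProduct.lift ((LinearMap.mul k A).compl₁₂ s (f.flip b ∘ₗ op'))
      map_add' := fun a b => TensorProduct.ext' fun x y => by simp [mul_add]
      map_smul' := fun c b => TensorProduct.ext' fun x y => by simp }
  have hT : ∀ x y, T (x ⊗ₜ MulOpposite.op y) = s x * s y := fun x y => rfl
  have hG : ∀ b x y, G b (x ⊗ₜ MulOpposite.op y) = s x * f y b := fun b x y => rfl
  have hTπ : ∀ t, π (T t) = AlgHom.mulLeftRight k B t 1 := fun t => by
    induction t with
    | zero => simp
    | add x y hx hy => simp [hx, hy]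
    | tmul x y => induction y with | _ y => simp [hT, hs]
  have hGπ : ∀ b t, π (G b t) = 0 := fun b t => by
    induction t with
    | zero => simp
    | add x y hx hy => simp [hx, hy]
    | tmul x y => induction y with | _ y => simp [hG, hπf]
  -- s is multiplicative up to values of `f`, and products of two such values vanish.
  have h1 : ∀ a b t, G b ((a ⊗ₜ 1) * t) = s a * G b t := fun a b t => by
    induction t with
    | zero => simp
    | add x y hx hy => rw [mul_add, map_add, hx, hy, map_add, mul_add]
    | tmul x y =>
      induction y with | _ y =>
      have := hker (f a x) (f y b) (hπf _ _) (hπf _ _)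
      rw [Algebra.TensorProduct.tmul_mul_tmul, one_mul, hG, hG]
      rw [hf a x, sub_mul] at this
      rw [← mul_assoc]
      exact (sub_eq_zero.1 this).symm
  -- This is the cocycle identity for `f`, multiplied on the left by s(x).
  have h2 : ∀ a b t, G b ((1 ⊗ₜ MulOpposite.op a) * t)
      = T t * f a b + G (a * b) t - G a t * s b := fun a b t => by
    induction t with
    | zero => simp
    | add x y hx hy => rw [mul_add, map_add, hx, hy]; simp only [map_add, add_mul]; abel
    | tmul x y =>
      induction y with | _ y =>
      rw [Algebra.TensorProduct.tmul_mul_tmul, one_mul, ← MulOpposite.op_mul]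
      simp only [hG, hT, hf, mul_assoc, mul_sub, sub_mul]
      abel
  refine exists_algHom_section_of_coboundary π hker s (G.flip e) hs (fun b => hGπ b e)
    fun a b => ?_
  have h3 := h1 a b e
  rw [he.tmul_one_mul, h2] at h3
  -- `T e` lifts e • 1 = 1, so it acts as the identity on the kernel.
  have h4 : (T e - 1) * f a b = 0 :=
    hker _ _ (by rw [map_sub, hTπ, he.apply_one, map_one, sub_self]) (hπf a b)
  rw [sub_mul, one_mul, sub_eq_zero] at h4
  rw [← hf, LinearMap.flip_apply, LinearMap.flip_apply, LinearMap.flip_apply, ← h3, h4]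
  abel

end Splitting

/-! ### Splitting from the vanishing of H². -/

section Hochschild

variable {k : Type u} [Field k] {B : Type v} [Ring B] [Algebra k B]

/-- H²(B, M) = 0, rewritten from multilinear maps on `Fin 2` to bilinear maps. -/
theorem Hochschild.eq_coboundary_of_dim_le_one (h : Hochschild.dim k B ≤ 1)
    (M : Type v) [AddCommGroup M] [Module k M] [Module B M] [Module Bᵐᵒᵖ M]
    [SMulCommClass B Bᵐᵒᵖ M] [IsScalarTower k B M] [IsScalarTower k Bᵐᵒᵖ M]
    (f : B →ₗ[k] B →ₗ[k] M)
    (hf : ∀ a b c, a • f b c - f (a * b) c + f a (b * c) - MulOpposite.op c • f a b = 0) :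
    ∃ g : B →ₗ[k] M, ∀ a b, f a b = a • g b - g (a * b) + MulOpposite.op b • g a := by
  have h2 : ¬ Hochschild.HasNonzero k B 2 := fun h2 => by
    have h3 : ((2 : ℕ) : ℕ∞) ≤ 1 := le_trans (le_sSup (show ((2 : ℕ) : ℕ∞) ∈
      {m : ℕ∞ | ∃ n : ℕ, Hochschild.HasNonzero k B n ∧ m = n} from ⟨2, h2, rfl⟩)) h
    exact absurd h3 (by norm_num)
  have hsub : Subsingleton (Hochschild.HH k B M 2) := by
    rw [← not_nontrivial_iff_subsingleton]
    exact fun hn => h2 ⟨M, inferInstance, inferInstance, inferInstance, inferInstance, inferInstance,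
      inferInstance, inferInstance, hn⟩
  let F : Hochschild.Cochain k B M 2 := LinearMap.uncurryLeft (M := fun _ : Fin 2 => B)
    ((MultilinearMap.ofSubsingletonₗ k k B M (0 : Fin 1)).toLinearMap ∘ₗ f)
  have hF : ∀ m, F m = f (m 0) (m 1) := fun m => rfl
  have hFc : F ∈ Hochschild.cocycles k B M 2 := by
    refine LinearMap.mem_ker.2 (funext fun b => ?_)
    have := hf (b 0) (b 1) (b 2)
    simp only [Hochschild.d, Hochschild.dFun, LinearMap.coe_mk, AddHom.coe_mk, hF,
      Fin.sum_univ_two]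
    simp [Fin.contractNth, Fin.tail, Fin.init]
    rw [← this]
    abel
  have hFb : F ∈ Hochschild.coboundaries k B M 2 := by
    have h0 := Subsingleton.elim (Submodule.Quotient.mk ⟨F, hFc⟩ : Hochschild.HH k B M 2) 0
    rw [Submodule.Quotient.mk_eq_zero] at h0
    exact h0
  obtain ⟨g, hg⟩ := hFb
  refine ⟨(MultilinearMap.ofSubsingletonₗ k k B M (0 : Fin 1)).symm g, fun a b => ?_⟩
  have := congrFun hg ![a, b]
  simp only [Hochschild.d, Hochschild.dFun, LinearMap.coe_mk, AddHom.coe_mk, hF] at this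
  have hg' : ∀ m : Fin 1 → B, g m
      = (MultilinearMap.ofSubsingletonₗ k k B M (0 : Fin 1)).symm g (m 0) := fun m =>
    congrArg g (funext fun i => by rw [Subsingleton.elim i 0])
  simp only [hg'] at this
  simp [Fin.contractNth, Fin.tail, Fin.init] at this
  rw [← this]
  abel

/-- The kernel becomes a B-bimodule through a linear section s, and the defect of s is a 2-cocycle
with values in it. `A` shares the universe of `B` because `HasNonzero` only tests bimodules there.
-/
theorem Hochschild.exists_algHom_section_of_dim_le_one {A : Type v} [Ring A] [Algebra k A]
    (h : Hochschild.dim k B ≤ 1) (π : A →ₐ[k] B) (hsurj : Function.Surjective π)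
    (hker : ∀ x y, π x = 0 → π y = 0 → x * y = 0) :
    ∃ σ : B →ₐ[k] A, ∀ b, π (σ b) = b := by
  obtain ⟨s, hs'⟩ := π.toLinearMap.exists_rightInverse_of_surjective
    (LinearMap.range_eq_top.2 hsurj)
  have hs : ∀ b, π (s b) = b := fun b => LinearMap.congr_fun hs' b
  let M := LinearMap.ker π.toLinearMap
  have hM : ∀ m : M, π m = 0 := fun m => m.2
  have e1 : ∀ (m : M), s 1 * (m : A) = m := fun m => by
    have := hker (s 1 - 1) m (by simp [hs]) (hM m)
    rwa [sub_mul, one_mul, sub_eq_zero] at this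
  have e2 : ∀ (m : M), (m : A) * s 1 = m := fun m => by
    have := hker m (s 1 - 1) (hM m) (by simp [hs])
    rwa [mul_sub, mul_one, sub_eq_zero] at this
  have m1 : ∀ a b (m : M), s (a * b) * (m : A) = s a * (s b * m) := fun a b m => by
    have := hker (s (a * b) - s a * s b) m (by simp [hs]) (hM m)
    rwa [sub_mul, sub_eq_zero, mul_assoc] at this
  have m2 : ∀ a b (m : M), (m : A) * s (a * b) = m * s a * s b := fun a b m => by
    have := hker m (s (a * b) - s a * s b) (hM m) (by simp [hs])
    rwa [mul_sub, sub_eq_zero, ← mul_assoc] at this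
  -- s need be neither unital nor multiplicative; its errors lie in the kernel and so act on the
  -- kernel as zero.
  let _ : Module B M :=
    { smul := fun b m => ⟨s b * m, LinearMap.mem_ker.2 (by simp [hM])⟩
      one_smul := fun m => Subtype.ext (e1 m)
      mul_smul := fun a b m => Subtype.ext (m1 a b m)
      smul_zero := fun b => Subtype.ext (mul_zero _)
      smul_add := fun b m n => Subtype.ext (mul_add _ _ _)
      add_smul := fun a b m => Subtype.ext (by
        change s (a + b) * (m : A) = s a * m + s b * m
        rw [map_add, add_mul])
      zero_smul := fun m => Subtype.ext (by
        change s 0 * (m : A) = 0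
        rw [map_zero, zero_mul]) }
  let _ : Module Bᵐᵒᵖ M :=
    { smul := fun b m => ⟨m * s b.unop, LinearMap.mem_ker.2 (by simp [hM])⟩
      one_smul := fun m => Subtype.ext (e2 m)
      mul_smul := fun a b m => Subtype.ext (m2 b.unop a.unop m)
      smul_zero := fun b => Subtype.ext (zero_mul _)
      smul_add := fun b m n => Subtype.ext (add_mul _ _ _)
      add_smul := fun a b m => Subtype.ext (by
        change (m : A) * s (a.unop + b.unop) = m * s a.unop + m * s b.unop
        rw [map_add, mul_add])
      zero_smul := fun m => Subtype.ext (by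
        change (m : A) * s 0 = 0
        rw [map_zero, mul_zero]) }
  have c1 : ∀ (b : B) (m : M), ((b • m : M) : A) = s b * m := fun b m => rfl
  have c2 : ∀ (b : B) (m : M), ((MulOpposite.op b • m : M) : A) = m * s b := fun b m => rfl
  have : SMulCommClass B Bᵐᵒᵖ M := ⟨fun a b m => Subtype.ext (mul_assoc _ _ _).symm⟩
  have : IsScalarTower k B M := ⟨fun c b m => Subtype.ext (by
    rw [c1, map_smul, smul_mul_assoc]; rfl)⟩
  have : IsScalarTower k Bᵐᵒᵖ M := ⟨fun c b m => Subtype.ext (by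
    change (m : A) * s (c • b.unop) = c • ((m : A) * s b.unop)
    rw [map_smul, mul_smul_comm])⟩
  let f : B →ₗ[k] B →ₗ[k] M := LinearMap.mk₂ k
    (fun a b => ⟨s a * s b - s (a * b), LinearMap.mem_ker.2 (by simp [hs])⟩)
    (fun a a' b => Subtype.ext (by
      simp only [map_add, add_mul, Submodule.coe_add]; abel))
    (fun c a b => Subtype.ext (by
      simp only [map_smul, smul_mul_assoc, Submodule.coe_smul, smul_sub]))
    (fun a b b' => Subtype.ext (by
      simp only [map_add, mul_add, Submodule.coe_add]; abel))
    (fun c a b => Subtype.ext (by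
      simp only [map_smul, mul_smul_comm, Submodule.coe_smul, smul_sub]))
  have hf : ∀ a b, (f a b : A) = s a * s b - s (a * b) := fun a b => rfl
  obtain ⟨g, hg⟩ := Hochschild.eq_coboundary_of_dim_le_one h M f fun a b c => Subtype.ext (by
    simp only [Submodule.coe_add, Submodule.coe_sub, c1, c2, hf, mul_sub, sub_mul, mul_assoc,
      Submodule.coe_zero]
    abel)
  refine exists_algHom_section_of_coboundary π hker s (M.subtype ∘ₗ g) hs (fun b => hM (g b))
    fun a b => ?_
  rw [← hf, hg]
  rfl

end Hochschild

/-! ### Separability elements of central simple algebras. -/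

section CentralSimple

variable {Z : Type*} [Field Z] {B : Type*} [Ring B] [Algebra Z B]

/-- B is a simple bimodule, since its subbimodules are two-sided ideals, and its bimodule
endomorphisms are the scalars from Z. Every Z-linear map commutes with these, so Jacobson density,
applied to a finite basis, realises it by an element of B ⊗ Bᵒᵖ. -/
theorem AlgHom.mulLeftRight_surjective_of_isSimpleRing [FiniteDimensional Z B] [IsSimpleRing B]
    [Algebra.IsCentral Z B] : Function.Surjective (AlgHom.mulLeftRight Z B) := by
  intro φ
  let _ : Module (B ⊗[Z] Bᵐᵒᵖ) B := TensorProduct.Algebra.module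
  have hsmul : ∀ (t : B ⊗[Z] Bᵐᵒᵖ) (x : B), t • x = AlgHom.mulLeftRight Z B t x :=
    fun t x => rfl
  have hl : ∀ a x : B, (a ⊗ₜ[Z] (1 : Bᵐᵒᵖ)) • x = a * x := fun a x => by simp [hsmul]
  have hr : ∀ a x : B, ((1 : B) ⊗ₜ[Z] MulOpposite.op a) • x = x * a := fun a x => by simp [hsmul]
  have hS : IsSimpleModule (B ⊗[Z] Bᵐᵒᵖ) B := by
    refine { exists_pair_ne := ⟨⊥, ⊤, bot_ne_top⟩, eq_bot_or_eq_top := fun N => ?_ }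
    let I : TwoSidedIdeal B := .mk' N N.zero_mem N.add_mem N.neg_mem
      (fun {x y} hy => by rw [← hl]; exact N.smul_mem _ hy)
      (fun {x y} hx => by rw [← hr]; exact N.smul_mem _ hx)
    have hI : ∀ x, x ∈ I ↔ x ∈ N := fun x => TwoSidedIdeal.mem_mk' ..
    rcases eq_bot_or_eq_top I with h | h
    · refine .inl (eq_bot_iff.2 fun x hx => ?_)
      rw [← hI, h] at hx
      simpa using hx
    · refine .inr (eq_top_iff.2 fun x _ => ?_)
      rw [← hI, h]
      trivial
  have hcent : ∀ f : Module.End (B ⊗[Z] Bᵐᵒᵖ) B, ∃ z : Z, ∀ x, f x = z • x := fun f => by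
    have h1 : ∀ x, f x = x * f 1 := fun x => by rw [← hl, ← map_smul, hl, mul_one]
    have h2 : ∀ x, f x = f 1 * x := fun x => by rw [← hr, ← map_smul, hr, one_mul]
    have h3 : f 1 ∈ Subalgebra.center Z B :=
      Subalgebra.mem_center_iff.2 fun x => by rw [← h1, ← h2]
    obtain ⟨z, hz⟩ := Algebra.mem_bot.1 (Algebra.IsCentral.out h3)
    exact ⟨z, fun x => by rw [h2, ← hz, Algebra.smul_def]⟩
  let f : Module.End (Module.End (B ⊗[Z] Bᵐᵒᵖ) B) B :=
    { toFun := φ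
      map_add' := map_add φ
      map_smul' := fun g x => by
        obtain ⟨z, hz⟩ := hcent g
        change φ (g x) = g (φ x)
        rw [hz, hz, map_smul] }
  classical
  obtain ⟨t, ht⟩ := jacobson_density f (Finset.univ.image (Module.finBasis Z B))
  exact ⟨t, (Module.finBasis Z B).ext fun i =>
    (ht _ (Finset.mem_image_of_mem _ (Finset.mem_univ i))).symm⟩

theorem AlgHom.mulLeftRight_bijective_of_isSimpleRing [FiniteDimensional Z B] [IsSimpleRing B]
    [Algebra.IsCentral Z B] : Function.Bijective (AlgHom.mulLeftRight Z B) := by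
  have hs := AlgHom.mulLeftRight_surjective_of_isSimpleRing (Z := Z) (B := B)
  refine ⟨?_, hs⟩
  refine (LinearMap.injective_iff_surjective_of_finrank_eq_finrank
    (f := (AlgHom.mulLeftRight Z B).toLinearMap) ?_).2 hs
  rw [Module.finrank_tensorProduct, Module.finrank_linearMap,
    ← (MulOpposite.opLinearEquiv Z (M := B)).finrank_eq]

/-- Take e acting as x ↦ τ(x)·1 for a functional τ with τ(1) = 1. Its values are central, so
multiplying them by b on the left or on the right is the same. -/
theorem exists_isSeparabilityElement_of_isCentral [FiniteDimensional Z B] [IsSimpleRing B]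
    [Algebra.IsCentral Z B] : ∃ e : B ⊗[Z] Bᵐᵒᵖ, IsSeparabilityElement Z e := by
  have hb := AlgHom.mulLeftRight_bijective_of_isSimpleRing (Z := Z) (B := B)
  obtain ⟨τ, hτ⟩ := (LinearMap.toSpanSingleton Z B 1).exists_leftInverse_of_injective
    (LinearMap.ker_toSpanSingleton Z one_ne_zero)
  have hτ1 : τ 1 = 1 := by simpa using LinearMap.congr_fun hτ 1
  obtain ⟨e, he⟩ := hb.2 ((Algebra.linearMap Z B) ∘ₗ τ)
  refine ⟨e, by simp [he, hτ1], fun b => hb.1 (LinearMap.ext fun x => ?_)⟩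
  simp [he, Algebra.commutes]

end CentralSimple

/-! ### Separability elements along a separable extension of the base field. -/

section Tower

variable {k Z B : Type*} [Field k] [Field Z] [Ring B] [Algebra k Z] [Algebra k B] [Algebra Z B]
  [IsScalarTower k Z B]

/-- Let E be the image in B ⊗ₖ Bᵒᵖ of the separability element of Z over k. As z ⊗ 1 and 1 ⊗ z agree
on E, the map x ⊗ y ↦ (x ⊗ y)E is well defined on B ⊗_Z Bᵒᵖ, and it carries e to the required
element. -/
theorem IsSeparabilityElement.exists_of_tower [FiniteDimensional k Z] [Algebra.IsSeparable k Z]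
    {e : B ⊗[Z] Bᵐᵒᵖ} (he : IsSeparabilityElement Z e) :
    ∃ e' : B ⊗[k] Bᵐᵒᵖ, IsSeparabilityElement k e' := by
  have := Algebra.FormallyUnramified.of_isSeparable k Z
  let ψ : Z ⊗[k] Z →ₐ[k] B ⊗[k] Bᵐᵒᵖ := Algebra.TensorProduct.map
    (IsScalarTower.toAlgHom k Z B) (IsScalarTower.toAlgHom k Z Bᵐᵒᵖ)
  set E := ψ (Algebra.FormallyUnramified.elem k Z) with hE
  have hEz : ∀ z : Z, (1 ⊗ₜ MulOpposite.op (algebraMap Z B z)) * E = (algebraMap Z B z ⊗ₜ 1) * E :=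
    fun z => by
      have := congrArg ψ (Algebra.FormallyUnramified.one_tmul_mul_elem (R := k) z)
      rw [map_mul, map_mul] at this
      simpa [ψ] using this
  have hE1 : AlgHom.mulLeftRight k B E 1 = 1 := by
    have : ∀ t, AlgHom.mulLeftRight k B (ψ t) 1
        = algebraMap Z B (Algebra.TensorProduct.lmul' k t) := fun t => by
      induction t with
      | zero => simp
      | add x y hx hy => simp [hx, hy]
      | tmul x y => simp [ψ]
    rw [hE, this, Algebra.FormallyUnramified.lmul_elem, map_one]
  let f : B →+ Bᵐᵒᵖ →+ B ⊗[k] Bᵐᵒᵖ := AddMonoidHom.mk'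
    (fun x => AddMonoidHom.mk' (fun y => (x ⊗ₜ y) * E)
      fun y y' => by rw [TensorProduct.tmul_add, add_mul])
    fun x x' => AddMonoidHom.ext fun y => by
      change ((x + x') ⊗ₜ y) * E = (x ⊗ₜ y) * E + (x' ⊗ₜ y) * E
      rw [TensorProduct.add_tmul, add_mul]
  let φ : B ⊗[Z] Bᵐᵒᵖ →+ B ⊗[k] Bᵐᵒᵖ := TensorProduct.liftAddHom f fun z x y => by
    induction y with | _ y =>
    have := congrArg ((x ⊗ₜ MulOpposite.op y) * ·) (hEz z)
    simp only [← mul_assoc, Algebra.TensorProduct.tmul_mul_tmul, mul_one,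
      ← MulOpposite.op_mul] at this
    change ((z • x) ⊗ₜ MulOpposite.op y) * E = (x ⊗ₜ (z • MulOpposite.op y)) * E
    rw [← MulOpposite.op_smul, Algebra.smul_def, Algebra.smul_def, Algebra.commutes z x]
    exact this.symm
  have hφ : ∀ x y, φ (x ⊗ₜ y) = (x ⊗ₜ y) * E := fun x y => rfl
  have h1 : ∀ t, AlgHom.mulLeftRight k B (φ t) 1 = AlgHom.mulLeftRight Z B t 1 := fun t => by
    induction t with
    | zero => simp
    | add x y hx hy => simp only [map_add, LinearMap.add_apply, hx, hy]
    | tmul x y => rw [hφ, map_mul, Module.End.mul_apply, hE1]; simp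
  have h2 : ∀ a b t, (a ⊗ₜ b) * φ t = φ ((a ⊗ₜ b) * t) := fun a b t => by
    induction t with
    | zero => simp
    | add x y hx hy => simp only [mul_add, map_add, hx, hy]
    | tmul x y =>
      rw [hφ, Algebra.TensorProduct.tmul_mul_tmul, hφ, ← mul_assoc,
        Algebra.TensorProduct.tmul_mul_tmul]
  exact ⟨φ e, by rw [h1, he.apply_one], fun b => by rw [h2, h2, he.tmul_one_mul]⟩

end Tower

/-! ### Separability elements of finite products. -/

section Pi

variable {k : Type*} [Field k] {ι : Type*} [Fintype ι] {C : ι → Type*} [∀ i, Ring (C i)]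
  [∀ i, Algebra k (C i)]

/-- The sum of the `e i`, each placed in its diagonal block, works: b acts on block i only through
`b i`. -/
theorem IsSeparabilityElement.exists_pi {e : ∀ i, C i ⊗[k] (C i)ᵐᵒᵖ}
    (he : ∀ i, IsSeparabilityElement k (e i)) :
    ∃ e' : (∀ i, C i) ⊗[k] (∀ i, C i)ᵐᵒᵖ, IsSeparabilityElement k e' := by
  classical
  let j : ∀ i, C i ⊗[k] (C i)ᵐᵒᵖ →ₗ[k] (∀ i, C i) ⊗[k] (∀ i, C i)ᵐᵒᵖ := fun i =>
    TensorProduct.map (LinearMap.single k C i)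
      ((MulOpposite.opLinearEquiv k).toLinearMap ∘ₗ LinearMap.single k C i ∘ₗ
        (MulOpposite.opLinearEquiv k).symm.toLinearMap)
  have hj : ∀ i x y, j i (x ⊗ₜ MulOpposite.op y)
      = Pi.single i x ⊗ₜ MulOpposite.op (Pi.single i y) := fun i x y => rfl
  have h1 : ∀ i t, AlgHom.mulLeftRight k (∀ i, C i) (j i t) 1
      = Pi.single i (AlgHom.mulLeftRight k (C i) t 1) := fun i t => by
    induction t with
    | zero => simp
    | add x y hx hy => simp [hx, hy, Pi.single_add]
    | tmul x y => induction y with | _ y => simp [hj, Pi.single_mul]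
  have h2 : ∀ i b t, (b ⊗ₜ 1) * j i t = j i ((b i ⊗ₜ 1) * t) := fun i b t => by
    induction t with
    | zero => simp
    | add x y hx hy => simp only [mul_add, map_add, hx, hy]
    | tmul x y =>
      induction y with | _ y =>
      simp only [hj, Algebra.TensorProduct.tmul_mul_tmul, one_mul]
      congr 1
      ext l
      rcases eq_or_ne l i with rfl | h <;> simp [*]
  have h3 : ∀ i b t, (1 ⊗ₜ MulOpposite.op b) * j i t = j i ((1 ⊗ₜ MulOpposite.op (b i)) * t) :=
    fun i b t => by
    induction t with
    | zero => simp
    | add x y hx hy => simp only [mul_add, map_add, hx, hy]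
    | tmul x y =>
      induction y with | _ y =>
      simp only [hj, Algebra.TensorProduct.tmul_mul_tmul, one_mul, ← MulOpposite.op_mul]
      congr 2
      ext l
      rcases eq_or_ne l i with rfl | h <;> simp [*]
  refine ⟨∑ i, j i (e i), ?_, fun b => ?_⟩
  · simp only [map_sum, LinearMap.sum_apply, h1, (he _).apply_one]
    exact Finset.univ_sum_single (1 : ∀ i, C i)
  · simp only [Finset.mul_sum, h2, h3, (he _).tmul_one_mul]

end Pi

/-! ### Simple algebras over a perfect field. -/

theorem IsSimpleRing.exists_field_isCentral (k : Type u) [Field k] (B : Type v) [Ring B]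
    [Algebra k B] [IsSimpleRing B] :
    ∃ (Z : Type v) (_ : Field Z) (_ : Algebra k Z) (_ : Algebra Z B),
      IsScalarTower k Z B ∧ Algebra.IsCentral Z B := by
  have hF : IsField (Subalgebra.center k B) := IsSimpleRing.isField_center B
  let F : Field (Subalgebra.center k B) := hF.toField
  let a : Algebra (Subalgebra.center k B) B := RingHom.toAlgebra' (Subalgebra.center k B).val
    fun z x => (Subalgebra.mem_center_iff.1 z.2 x).symm
  exact ⟨Subalgebra.center k B, F, inferInstanceAs (Algebra k (Subalgebra.center k B)), a,
    .of_algebraMap_eq fun x => rfl, ⟨fun x hx => Algebra.mem_bot.2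
      ⟨⟨x, Subalgebra.mem_center_iff.2 (Subalgebra.mem_center_iff.1 hx)⟩, rfl⟩⟩⟩

/-- The centre Z is a finite extension of a perfect field, hence separable, and B is central simple
over Z. -/
theorem IsSimpleRing.exists_isSeparabilityElement {k : Type u} [Field k] [PerfectField k]
    (B : Type v) [Ring B] [Algebra k B] [FiniteDimensional k B] [IsSimpleRing B] :
    ∃ e : B ⊗[k] Bᵐᵒᵖ, IsSeparabilityElement k e := by
  obtain ⟨Z, _, _, _, _, _⟩ := IsSimpleRing.exists_field_isCentral k B
  have : FiniteDimensional Z B := .right k Z B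
  have : FiniteDimensional k Z := .left k Z B
  obtain ⟨e, he⟩ := exists_isSeparabilityElement_of_isCentral (Z := Z) (B := B)
  exact he.exists_of_tower

theorem TwoSidedIdeal.nonempty_algEquiv_quotient {k R P : Type*} [CommRing k] [Ring R] [Ring P]
    [Algebra k R] [Algebra k P] (f : R →ₐ[k] P) (hf : Function.Surjective f)
    (I : TwoSidedIdeal R) (hI : ∀ x, x ∈ I ↔ f x = 0) :
    Nonempty (P ≃ₐ[k] I.ringCon.Quotient) := by
  have hrel : ∀ x y, I.ringCon x y ↔ f x = f y := fun x y => by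
    rw [TwoSidedIdeal.rel_iff, hI, map_sub, sub_eq_zero]
  let g : I.ringCon.Quotient →ₐ[k] P := I.ringCon.liftₐ f fun x y h => (hrel x y).1 h
  have hg : ∀ x : R, g x = f x := fun x => rfl
  refine ⟨(AlgEquiv.ofBijective g ⟨fun x y h => ?_, fun p => ?_⟩).symm⟩
  · obtain ⟨x, rfl⟩ := I.ringCon.mk'_surjective x
    obtain ⟨y, rfl⟩ := I.ringCon.mk'_surjective y
    exact (RingCon.eq I.ringCon).2 ((hrel x y).2 h)
  · obtain ⟨x, rfl⟩ := hf p
    exact ⟨x, hg x⟩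

/-! ### Ideals and relations of the generalized path algebra. -/

namespace GenPath

namespace GenPathAlgebra

variable {k : Type*} [Field k] {V : Type*} {Q : Quiver V} {𝒜 : V → Type*} [∀ i, Ring (𝒜 i)]
  [∀ i, Algebra k (𝒜 i)]

theorem ofPath_induction {motive : GenPathAlgebra k Q 𝒜 → Prop} (y : GenPathAlgebra k Q 𝒜)
    (zero : motive 0) (add : ∀ y z, motive y → motive z → motive (y + z))
    (smul : ∀ (c : k) y, motive y → motive (c • y))
    (ofPath : ∀ (i j : V) (p : APath Q 𝒜 i j), motive (ofPath k p)) : motive y := by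
  obtain ⟨y, rfl⟩ := mk_surjective k y
  have hy : y ∈ Submodule.span k
      {y : PathSpace k Q 𝒜 | ∃ (i j : V) (p : APath Q 𝒜 i j), y = basisPath k p} := by
    rw [span_basisPath]; trivial
  induction hy using Submodule.span_induction with
  | zero => rwa [map_zero]
  | add a b _ _ ha hb => rw [map_add]; exact add _ _ ha hb
  | smul c a _ ha => rw [map_smul]; exact smul _ _ ha
  | mem y hy => obtain ⟨i, j, p, rfl⟩ := hy; exact ofPath i j p

theorem ofPath_add {i j : V} {p q r : APath Q 𝒜 i j} (h : APath.IsAdd p q r) :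
    ofPath k p = ofPath k q + ofPath k r := by
  have := mk_eq_zero k (Submodule.subset_span (.inl ⟨i, j, p, q, r, h, rfl⟩) :
    basisPath k p - (basisPath k q + basisPath k r) ∈ linRel k Q 𝒜)
  rw [map_sub, map_add, sub_eq_zero] at this
  exact this

theorem ofPath_smul {i j : V} {c : k} {p q : APath Q 𝒜 i j} (h : APath.IsSMul c p q) :
    ofPath k p = c • ofPath k q := by
  have := mk_eq_zero k (Submodule.subset_span (.inr ⟨i, j, c, p, q, h, rfl⟩) :
    basisPath k p - c • basisPath k q ∈ linRel k Q 𝒜)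
  rw [map_sub, map_smul, sub_eq_zero] at this
  exact this

variable [Fintype V]

theorem ofPath_mul_ofPath {i j l : V} (p : APath Q 𝒜 i j) (q : APath Q 𝒜 j l) :
    ofPath k p * ofPath k q = ofPath k (p.comp q) := by
  change mulMap k Q 𝒜 (mk k Q 𝒜 _) (mk k Q 𝒜 _) = _
  rw [mulMap_mk, mulPre_basis, mulPaths_comp]
  rfl

theorem ofPath_mul_ofPath_of_ne {i j j' l : V} (h : j ≠ j') (p : APath Q 𝒜 i j)
    (q : APath Q 𝒜 j' l) : ofPath k p * ofPath k q = 0 := by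
  change mulMap k Q 𝒜 (mk k Q 𝒜 _) (mk k Q 𝒜 _) = _
  rw [mulMap_mk, mulPre_basis, mulPaths_ne k h, map_zero]

variable (k Q 𝒜) in
/-- The linear map that sends a family `c` to the sum of the paths `c i` of length zero. -/
noncomputable def ofVertices : (∀ i, 𝒜 i) →ₗ[k] GenPathAlgebra k Q 𝒜 :=
  ∑ i, { toFun := fun c => ofPath k (APath.nil (c i))
         map_add' := fun c d => ofPath_add (.nil (c i) (d i))
         map_smul' := fun _ c => ofPath_smul (.nil (c i)) }

theorem ofVertices_apply (c : ∀ i, 𝒜 i) :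
    ofVertices k Q 𝒜 c = ∑ i, ofPath k (APath.nil (c i)) := by
  simp [ofVertices]

theorem ofVertices_single [DecidableEq V] (i : V) (a : 𝒜 i) :
    ofVertices k Q 𝒜 (Pi.single i a) = ofPath k (APath.nil a) := by
  have h0 : ∀ j, ofPath k (APath.nil (0 : 𝒜 j) : APath Q 𝒜 j j) = 0 := fun j => by
    have := ofPath_smul (k := k) (Q := Q) (𝒜 := 𝒜) (.nil (c := (0 : k)) (0 : 𝒜 j))
    rwa [zero_smul, zero_smul] at this
  rw [ofVertices_apply, Finset.sum_eq_single i, Pi.single_eq_same]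
  · intro j _ hj
    rw [Pi.single_eq_of_ne hj, h0]
  · exact fun h => absurd (Finset.mem_univ i) h

theorem ofVertices_one : ofVertices k Q 𝒜 1 = 1 := by
  rw [ofVertices_apply]
  exact (map_sum (mk k Q 𝒜) _ _).symm

/-- A path of positive length factors through its first arrow as (a β 1)·p, so modulo J̃ only paths
of length zero remain. -/
theorem exists_sub_ofVertices_mem_arrowIdeal (y : GenPathAlgebra k Q 𝒜) :
    ∃ c, y - ofVertices k Q 𝒜 c ∈ arrowIdeal k Q 𝒜 := by
  classical
  induction y using ofPath_induction with
  | zero => exact ⟨0, by rw [map_zero, sub_zero]; exact zero_mem _⟩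
  | add y z hy hz =>
    obtain ⟨c, hc⟩ := hy
    obtain ⟨d, hd⟩ := hz
    refine ⟨c + d, ?_⟩
    rw [map_add, add_sub_add_comm]
    exact add_mem hc hd
  | smul a y hy =>
    obtain ⟨c, hc⟩ := hy
    refine ⟨a • c, ?_⟩
    rw [map_smul, ← smul_sub, Algebra.smul_def]
    exact TwoSidedIdeal.mul_mem_left _ _ _ hc
  | ofPath i j p =>
    cases p with
    | nil a => exact ⟨Pi.single i a, by rw [ofVertices_single, sub_self]; exact zero_mem _⟩
    | cons a β p =>
      refine ⟨0, ?_⟩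
      have : ofPath k (APath.cons a β p)
          = ofPath k (APath.cons a β (APath.nil 1)) * ofPath k p := by
        rw [ofPath_mul_ofPath, APath.comp, APath.one_comp]
      rw [map_zero, sub_zero, this]
      exact TwoSidedIdeal.mul_mem_right _ _ _ (TwoSidedIdeal.subset_span ⟨_, _, _, rfl, rfl⟩)

theorem isRelation_mul_mul (i j : V) (y : GenPathAlgebra k Q 𝒜) :
    IsRelation k (ofPath k (APath.nil (1 : 𝒜 i)) * y * ofPath k (APath.nil (1 : 𝒜 j))) := by
  refine ⟨i, j, ?_⟩
  induction y using ofPath_induction with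
  | zero => simp
  | add y z hy hz => rw [mul_add, add_mul]; exact add_mem hy hz
  | smul a y hy => rw [mul_smul_comm, smul_mul_assoc]; exact Submodule.smul_mem _ _ hy
  | ofPath i' j' p =>
    by_cases hi : i = i'
    · by_cases hj : j' = j
      · subst hi hj
        rw [ofPath_mul_ofPath, ofPath_mul_ofPath]
        exact Submodule.subset_span ⟨_, rfl⟩
      · subst hi
        rw [ofPath_mul_ofPath, ofPath_mul_ofPath_of_ne hj]
        exact zero_mem _
    · rw [ofPath_mul_ofPath_of_ne hi, zero_mul]
      exact zero_mem _

/-- A two-sided ideal is generated by the relations that it contains. -/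
theorem span_isRelation_mem (I : TwoSidedIdeal (GenPathAlgebra k Q 𝒜)) :
    TwoSidedIdeal.span {σ | IsRelation k σ ∧ σ ∈ I} = I := by
  refine le_antisymm (TwoSidedIdeal.span_le.2 fun σ hσ => hσ.2) fun y hy => ?_
  -- Peirce decomposition for 1 = ∑ eᵢ: every component eᵢ y eⱼ is a relation and stays in the
  -- ideal.
  have : y = ∑ i, ∑ j, ofPath k (APath.nil (1 : 𝒜 i)) * y * ofPath k (APath.nil (1 : 𝒜 j)) := by
    simp_rw [← Finset.mul_sum, ← Finset.sum_mul]
    change y = (∑ i, ofPath k (APath.nil ((1 : ∀ i, 𝒜 i) i))) * y *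
      ∑ i, ofPath k (APath.nil ((1 : ∀ i, 𝒜 i) i))
    rw [← ofVertices_apply, ofVertices_one, one_mul, mul_one]
  rw [this]
  exact sum_mem fun i _ => sum_mem fun j _ => TwoSidedIdeal.subset_span
    ⟨isRelation_mul_mul i j y, TwoSidedIdeal.mul_mem_right _ _ _
      (TwoSidedIdeal.mul_mem_left _ _ _ hy)⟩

end GenPathAlgebra

/-! ### The evaluation homomorphism and its kernel. -/

section Eval

variable {k : Type*} [Field k] {V : Type*} [DecidableEq V] {Q : Quiver V}
  {𝒜 : V → Type*} [∀ i, Ring (𝒜 i)] [∀ i, Algebra k (𝒜 i)] {A : Type*} [Ring A] [Algebra k A]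
  (σ : (∀ i, 𝒜 i) →ₐ[k] A) (x : ∀ i j, Q.Hom i j → A)

/-- The value of an `𝒜`-path when the algebra entries are evaluated by `σ` and the arrows by `x`. -/
def APath.eval : ∀ {i j : V}, APath Q 𝒜 i j → A
  | _, _, .nil a => σ (Pi.single _ a)
  | _, _, .cons a β p => σ (Pi.single _ a) * x _ _ β * p.eval

theorem APath.eval_comp {i j l : V} (p : APath Q 𝒜 i j) (q : APath Q 𝒜 j l) :
    (p.comp q).eval σ x = p.eval σ x * q.eval σ x := by
  induction p with
  | nil a => cases q <;> simp [comp, eval, Pi.single_mul, mul_assoc]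
  | cons a β p ih => simp [comp, eval, ih, mul_assoc]

/-- Insert the identities of the end algebras between the factors: σ sends them to orthogonal
idempotents. -/
theorem APath.eval_mul_eval_of_ne {i j j' l : V} (h : j ≠ j') (p : APath Q 𝒜 i j)
    (q : APath Q 𝒜 j' l) : p.eval σ x * q.eval σ x = 0 := by
  have h1 : (Pi.single j 1 * Pi.single j' 1 : ∀ i, 𝒜 i) = 0 := by
    ext m
    by_cases hm : m = j
    · subst hm; simp [h]
    · simp [hm]
  rw [← p.comp_one, ← q.one_comp, eval_comp, eval_comp, mul_assoc, ← mul_assoc (eval σ x (nil 1))]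
  simp [eval, ← map_mul, h1]

theorem APath.IsAdd.eval_eq {i j : V} {p q r : APath Q 𝒜 i j} (h : IsAdd p q r) :
    p.eval σ x = q.eval σ x + r.eval σ x := by
  induction h with
  | nil a b => simp [APath.eval, Pi.single_add]
  | head a b β p => simp [APath.eval, Pi.single_add, add_mul]
  | tail a β _ ih => simp [APath.eval, ih, mul_add]

theorem APath.IsSMul.eval_eq {c : k} {i j : V} {p q : APath Q 𝒜 i j} (h : IsSMul c p q) :
    p.eval σ x = c • q.eval σ x := by
  induction h with
  | nil a => simp [APath.eval, Pi.single_smul]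
  | head a β p => simp [APath.eval, Pi.single_smul]
  | tail a β _ ih => simp [APath.eval, ih]

namespace GenPathAlgebra

theorem lift_basisPath {i j : V} (p : APath Q 𝒜 i j) :
    Finsupp.lift A k _ (fun P : Σ i j : V, APath Q 𝒜 i j => P.2.2.eval σ x) (basisPath k p)
      = p.eval σ x := by
  simp [basisPath]

/-- The linear map underlying `GenPathAlgebra.eval`. -/
noncomputable def evalLinear : GenPathAlgebra k Q 𝒜 →ₗ[k] A :=
  (linRel k Q 𝒜).liftQ (Finsupp.lift A k _ fun P => P.2.2.eval σ x) <| by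
    rw [linRel, Submodule.span_le]
    rintro _ (⟨i, j, p, q, r, h, rfl⟩ | ⟨i, j, c, p, q, h, rfl⟩)
    · rw [SetLike.mem_coe, LinearMap.mem_ker, map_sub, map_add, lift_basisPath, lift_basisPath,
        lift_basisPath, h.eval_eq, sub_self]
    · rw [SetLike.mem_coe, LinearMap.mem_ker, map_sub, map_smul, lift_basisPath, lift_basisPath,
        h.eval_eq, sub_self]

theorem evalLinear_ofPath {i j : V} (p : APath Q 𝒜 i j) :
    evalLinear σ x (ofPath k p) = p.eval σ x :=
  lift_basisPath σ x p

variable [Fintype V]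

theorem evalLinear_ofVertices (c : ∀ i, 𝒜 i) : evalLinear σ x (ofVertices k Q 𝒜 c) = σ c := by
  simp only [ofVertices_apply, map_sum, evalLinear_ofPath, APath.eval]
  rw [← map_sum, Finset.univ_sum_single]

theorem evalLinear_mul (y z : GenPathAlgebra k Q 𝒜) :
    evalLinear σ x (y * z) = evalLinear σ x y * evalLinear σ x z := by
  induction y using ofPath_induction with
  | zero => simp
  | add y z hy hz => simp only [add_mul, map_add, hy, hz]
  | smul a y hy => simp only [smul_mul_assoc, map_smul, hy]
  | ofPath i j p =>
  induction z using ofPath_induction with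
  | zero => simp
  | add y z hy hz => simp only [mul_add, map_add, hy, hz]
  | smul a y hy => simp only [mul_smul_comm, map_smul, hy]
  | ofPath j' l q =>
  by_cases h : j = j'
  · subst h
    simp only [ofPath_mul_ofPath, evalLinear_ofPath, APath.eval_comp]
  · simp only [ofPath_mul_ofPath_of_ne h, evalLinear_ofPath, APath.eval_mul_eval_of_ne _ _ h,
      map_zero]

/-- The algebra homomorphism from the generalized path algebra that evaluates the algebra entries by
`σ` and the arrows by `x`. -/
noncomputable def eval : GenPathAlgebra k Q 𝒜 →ₐ[k] A :=
  AlgHom.ofLinearMap (evalLinear σ x)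
    (by rw [← ofVertices_one, evalLinear_ofVertices, map_one]) (evalLinear_mul σ x)

theorem eval_ofPath {i j : V} (p : APath Q 𝒜 i j) : eval σ x (ofPath k p) = p.eval σ x :=
  evalLinear_ofPath σ x p

theorem eval_ofVertices (c : ∀ i, 𝒜 i) : eval σ x (ofVertices k Q 𝒜 c) = σ c :=
  evalLinear_ofVertices σ x c

variable {σ x} (π : A →ₐ[k] ∀ i, 𝒜 i)

theorem eval_arrowIdeal (hx : ∀ i j β, π (x i j β) = 0) {y : GenPathAlgebra k Q 𝒜}
    (hy : y ∈ arrowIdeal k Q 𝒜) :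
    π (eval σ x y) = 0 := by
  have : arrowIdeal k Q 𝒜 ≤ TwoSidedIdeal.ker (π.comp (eval σ x)) := by
    refine TwoSidedIdeal.span_le.2 ?_
    rintro _ ⟨i, j, p, hp, rfl⟩
    cases p with
    | nil a => simp [APath.length] at hp
    | cons a β p => simp [TwoSidedIdeal.mem_ker, eval_ofPath, APath.eval, hx]
  exact (TwoSidedIdeal.mem_ker _).1 (this hy)

/-- Modulo J̃, y is a family c of vertex elements. Since π ∘ eval kills J̃ and returns c on the
vertex part, c = 0. -/
theorem mem_arrowIdeal_of_eval_eq_zero (hσ : ∀ b, π (σ b) = b)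
    (hx : ∀ i j β, π (x i j β) = 0) {y : GenPathAlgebra k Q 𝒜} (hy : eval σ x y = 0) :
    y ∈ arrowIdeal k Q 𝒜 := by
  obtain ⟨c, hc⟩ := exists_sub_ofVertices_mem_arrowIdeal y
  have h1 := eval_arrowIdeal (σ := σ) π hx hc
  rw [map_sub, hy, eval_ofVertices, zero_sub, map_neg, hσ, neg_eq_zero] at h1
  rwa [h1, map_zero, sub_zero] at hc

/-- An extension of `∏ᵢ 𝒜 i` by an ideal of square zero that is split by `σ` and generated by `σ` and
the values `x` of the arrows is a quotient of the generalized path algebra by relations. -/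
theorem exists_relations (hσ : ∀ b, π (σ b) = b) (hx : ∀ i j β, π (x i j β) = 0)
    (hker : ∀ a b, π a = 0 → π b = 0 → a * b = 0)
    (hgen : ∀ a, π a = 0 → a ∈ (eval σ x).range) :
    ∃ ρ : Set (GenPathAlgebra k Q 𝒜), (∀ σ ∈ ρ, IsRelation k σ) ∧
      (arrowIdeal k Q 𝒜).asIdeal ^ 2 ≤ (TwoSidedIdeal.span ρ).asIdeal ∧
      TwoSidedIdeal.span ρ ≤ arrowIdeal k Q 𝒜 ∧
      Nonempty (A ≃ₐ[k] (TwoSidedIdeal.span ρ).ringCon.Quotient) := by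
  refine ⟨{τ | IsRelation k τ ∧ τ ∈ TwoSidedIdeal.ker (eval σ x)}, fun τ hτ => hτ.1, ?_⟩
  rw [span_isRelation_mem]
  refine ⟨?_, fun y hy => mem_arrowIdeal_of_eval_eq_zero π hσ hx hy,
    TwoSidedIdeal.nonempty_algEquiv_quotient (eval σ x) (fun a => ?_) _ fun y => Iff.rfl⟩
  · rw [Submodule.pow_succ, Submodule.pow_one, Ideal.mul_le]
    intro y hy z hz
    rw [TwoSidedIdeal.mem_asIdeal, TwoSidedIdeal.mem_ker, map_mul]
    exact hker _ _ (eval_arrowIdeal π hx hy) (eval_arrowIdeal π hx hz)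
  -- Surjectivity: A is the sum of ker π and the image of σ.
  · have h1 := hgen (a - σ (π a)) (by rw [map_sub, hσ, sub_self])
    have h2 : σ (π a) ∈ (eval σ x).range := ⟨_, eval_ofVertices σ x (π a)⟩
    have h3 := add_mem h1 h2
    rwa [sub_add_cancel] at h3

end GenPathAlgebra

end Eval

end GenPath

/-! ### The radical as a bimodule, and the section. -/

namespace SimpleDecomposition

variable {k : Type u} [Field k]

theorem nonempty_of_isSemisimpleRing (B : Type v) [Ring B] [Algebra k B] [IsSemisimpleRing B] :
    Nonempty (SimpleDecomposition k B) := by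
  obtain ⟨n, D, d, _, _, _, ⟨e⟩⟩ :=
    IsSemisimpleRing.exists_algEquiv_pi_matrix_divisionRing k B
  exact ⟨{ ι := Fin n, comp := fun i => Matrix (Fin (d i)) (Fin (d i)) (D i), equiv := e }⟩

variable {A : Type v} [Ring A] [Algebra k A] (D : SimpleDecomposition k (A ⧸ Ring.jacobson A))

/-- The projection of `A` to the product of the simple summands of `A/r`. -/
noncomputable def proj : A →ₐ[k] ∀ i, D.comp i :=
  D.equiv.toAlgHom.comp (Ideal.Quotient.mkₐ k (Ring.jacobson A))

theorem proj_surjective : Function.Surjective D.proj :=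
  D.equiv.surjective.comp Ideal.Quotient.mk_surjective

theorem proj_eq_zero_iff {a : A} : D.proj a = 0 ↔ a ∈ Ring.jacobson A := by
  change D.equiv (Ideal.Quotient.mk (Ring.jacobson A) a) = 0 ↔ _
  rw [map_eq_zero_iff _ D.equiv.injective, Ideal.Quotient.eq_zero_iff_mem]

theorem mem_lift {i : D.ι} {a : A} : a ∈ D.lift i ↔ ∀ j, j ≠ i → D.proj a j = 0 := Iff.rfl

theorem proj_eq_single [DecidableEq D.ι] {i : D.ι} {a : A} (ha : a ∈ D.lift i) :
    D.proj a = Pi.single i (D.proj a i) := by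
  ext j
  by_cases h : j = i
  · subst h; simp
  · rw [Pi.single_eq_of_ne h, D.mem_lift.1 ha j h]

theorem lift_mul_lift_le (i : D.ι) : D.lift i * D.lift i ≤ D.lift i :=
  Submodule.mul_le.2 fun a ha b _ j hj => by
    change D.proj (a * b) j = 0
    rw [map_mul, Pi.mul_apply, D.mem_lift.1 ha j hj, zero_mul]

theorem lift_mul_jacobson_le (i : D.ι) :
    D.lift i * (Ring.jacobson A).restrictScalars k ≤ (Ring.jacobson A).restrictScalars k :=
  Submodule.mul_le.2 fun a _ _ hb => Ideal.mul_mem_left (Ring.jacobson A) a hb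

theorem bimodule_le (i j : D.ι) : D.bimodule i j ≤ (Ring.jacobson A).restrictScalars k :=
  Submodule.mul_le.2 fun _ ha b _ =>
    Ideal.mul_mem_right b (Ring.jacobson A) (D.lift_mul_jacobson_le i ha)

variable {D}

theorem mul_eq_zero_of_jacobson_sq (hr : Ring.jacobson A ^ 2 = ⊥) {a b : A}
    (ha : a ∈ Ring.jacobson A) (hb : b ∈ Ring.jacobson A) : a * b = 0 := by
  rw [Submodule.pow_succ, Submodule.pow_one] at hr
  have := Ideal.mul_mem_mul ha hb
  rwa [hr] at this

/-- This is the action of A/r on r. It permits replacing a by σ(π a) in products with elements of r.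
-/
theorem mul_eq_of_proj_eq_left (hr : Ring.jacobson A ^ 2 = ⊥) {a b x : A}
    (h : D.proj a = D.proj b) (hx : x ∈ Ring.jacobson A) : a * x = b * x := by
  have := mul_eq_zero_of_jacobson_sq hr
    (D.proj_eq_zero_iff.1 (by rw [map_sub, h, sub_self] : D.proj (a - b) = 0)) hx
  rwa [sub_mul, sub_eq_zero] at this

theorem mul_eq_of_proj_eq_right (hr : Ring.jacobson A ^ 2 = ⊥) {a b x : A}
    (h : D.proj a = D.proj b) (hx : x ∈ Ring.jacobson A) : x * a = x * b := by
  have := mul_eq_zero_of_jacobson_sq hr hx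
    (D.proj_eq_zero_iff.1 (by rw [map_sub, h, sub_self] : D.proj (a - b) = 0))
  rwa [mul_sub, sub_eq_zero] at this

section

variable [DecidableEq D.ι] {e : D.ι → A}

theorem mem_lift_of_proj_eq_single {i : D.ι} {a : A} {b : D.comp i}
    (h : D.proj a = Pi.single i b) : a ∈ D.lift i :=
  D.mem_lift.2 fun j hj => by rw [h, Pi.single_eq_of_ne hj]

/-- The `e i` need not be idempotent: acting on r, only their classes in A/r matter. -/
theorem mul_mul_eq_of_mem_bimodule (hr : Ring.jacobson A ^ 2 = ⊥)
    (he : ∀ i, D.proj (e i) = Pi.single i 1) {i j : D.ι} {m : A} (hm : m ∈ D.bimodule i j) :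
    e i * m * e j = m := by
  have h1 : e i * m = m := by
    have : D.bimodule i j ≤ LinearMap.eqLocus (LinearMap.mulLeft k (e i)) LinearMap.id := by
      rw [bimodule, mul_assoc]
      refine Submodule.mul_le.2 fun a ha b hb => ?_
      have hb' : b ∈ Ring.jacobson A :=
        (Submodule.mul_le.2 fun x hx y _ => Ideal.mul_mem_right y (Ring.jacobson A) hx :
          (Ring.jacobson A).restrictScalars k * D.lift j ≤ (Ring.jacobson A).restrictScalars k) hb
      rw [LinearMap.mem_eqLocus, LinearMap.mulLeft_apply, LinearMap.id_apply, ← mul_assoc]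
      refine mul_eq_of_proj_eq_left (D := D) hr ?_ hb'
      rw [map_mul, he, D.proj_eq_single ha, ← Pi.single_mul, one_mul]
    exact this hm
  have h2 : m * e j = m := by
    have : D.bimodule i j ≤ LinearMap.eqLocus (LinearMap.mulRight k (e j)) LinearMap.id := by
      refine Submodule.mul_le.2 fun a ha b hb => ?_
      rw [LinearMap.mem_eqLocus, LinearMap.mulRight_apply, LinearMap.id_apply, mul_assoc]
      refine mul_eq_of_proj_eq_right (D := D) hr ?_ (D.lift_mul_jacobson_le i ha)
      rw [map_mul, he, D.proj_eq_single hb, ← Pi.single_mul, mul_one]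
    exact this hm
  rw [h1, h2]

end

variable [FiniteDimensional k A]

/-- `rank` is an `sInf` in ℕ, with value 0 on the empty set, so a finite generating set must be
exhibited. A finite k-spanning set of ᵢMⱼ is one, because Āᵢ · ᵢMⱼ · Āⱼ = ᵢMⱼ. -/
theorem exists_generates_card_eq_rank (hr : Ring.jacobson A ^ 2 = ⊥) (i j : D.ι) :
    ∃ X : Finset A, D.Generates i j X ∧ X.card = D.rank i j := by
  classical
  obtain ⟨X, hX⟩ := IsNoetherian.noetherian (D.bimodule i j)
  choose e he using fun i => D.proj_surjective (Pi.single i 1)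
  have hle : D.lift i * D.bimodule i j * D.lift j = D.bimodule i j := by
    refine le_antisymm ?_ fun m hm => ?_
    · calc D.lift i * D.bimodule i j * D.lift j
          = (D.lift i * D.lift i) * (Ring.jacobson A).restrictScalars k
              * (D.lift j * D.lift j) := by simp only [bimodule, mul_assoc]
        _ ≤ _ := mul_le_mul' (mul_le_mul' (D.lift_mul_lift_le i) le_rfl)
            (D.lift_mul_lift_le j)
    · rw [← mul_mul_eq_of_mem_bimodule hr he hm]
      exact Submodule.mul_mem_mul (Submodule.mul_mem_mul (mem_lift_of_proj_eq_single (he i)) hm)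
        (mem_lift_of_proj_eq_single (he j))
  have hg : D.Generates i j X := ⟨by rw [← hX]; exact Submodule.subset_span, by rw [hX, hle]⟩
  exact Nat.sInf_mem (s := {n | ∃ X : Finset A, D.Generates i j X ∧ X.card = n})
    ⟨X.card, X, hg, rfl⟩

theorem exists_relations_of_section (hr : Ring.jacobson A ^ 2 = ⊥)
    (σ : (∀ i, D.comp i) →ₐ[k] A) (hσ : ∀ b, D.proj (σ b) = b) :
    ∃ ρ : Set (GenPath.GenPathAlgebra k D.quiver D.comp),
      (∀ σ ∈ ρ, GenPath.GenPathAlgebra.IsRelation k σ) ∧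
      (GenPath.GenPathAlgebra.arrowIdeal k D.quiver D.comp).asIdeal ^ 2 ≤
        (TwoSidedIdeal.span ρ).asIdeal ∧
      TwoSidedIdeal.span ρ ≤ GenPath.GenPathAlgebra.arrowIdeal k D.quiver D.comp ∧
      Nonempty (A ≃ₐ[k] (TwoSidedIdeal.span ρ).ringCon.Quotient) := by
  classical
  choose X hX hcard using fun i j => exists_generates_card_eq_rank (D := D) hr i j
  -- Arrows i → j are the elements of `Fin (D.rank i j)`, so they enumerate a least generating set.
  let x : ∀ i j, D.quiver.Hom i j → A := fun i j β => ((X i j).equivFinOfCardEq (hcard i j)).symm β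
  have hxX : ∀ i j β, x i j β ∈ X i j := fun i j β => Subtype.prop _
  have hXx : ∀ i j, ∀ y ∈ X i j, ∃ β, x i j β = y := fun i j y hy =>
    ⟨(X i j).equivFinOfCardEq (hcard i j) ⟨y, hy⟩, by simp [x]⟩
  have hxr : ∀ i j β, x i j β ∈ Ring.jacobson A := fun i j β =>
    D.bimodule_le i j ((hX i j).1 (hxX i j β))
  let e : D.ι → A := fun i => σ (Pi.single i 1)
  have he : ∀ i, D.proj (e i) = Pi.single i 1 := fun i => hσ _
  have hsum : ∑ i, e i = 1 := by
    rw [← map_sum]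
    exact (congrArg σ (Finset.univ_sum_single (1 : ∀ i, D.comp i))).trans (map_one σ)
  set S := (GenPath.GenPathAlgebra.eval (Q := D.quiver) σ x).range with hS
  have hσS : ∀ b, σ b ∈ S := fun b => ⟨_, GenPath.GenPathAlgebra.eval_ofVertices σ x b⟩
  have hXS : ∀ i j, ∀ y ∈ X i j, y ∈ S := fun i j y hy => by
    obtain ⟨β, rfl⟩ := hXx i j y hy
    refine ⟨GenPath.GenPathAlgebra.ofPath k (.cons 1 β (.nil 1)), ?_⟩
    -- The path 1 β 1 has value eᵢ x eⱼ, which is x itself.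
    exact (GenPath.GenPathAlgebra.eval_ofPath σ x _).trans
      (mul_mul_eq_of_mem_bimodule hr he ((hX i j).1 hy))
  have hspan : ∀ i j, Submodule.span k (X i j : Set A) ≤ Subalgebra.toSubmodule S := fun i j =>
    Submodule.span_le.2 (hXS i j)
  have hspanr : ∀ i j, Submodule.span k (X i j : Set A) ≤ (Ring.jacobson A).restrictScalars k :=
    fun i j => Submodule.span_le.2 fun y hy => D.bimodule_le i j ((hX i j).1 hy)
  have hbi : ∀ i j, D.bimodule i j ≤ Subalgebra.toSubmodule S := fun i j => by
    rw [← (hX i j).2]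
    refine Submodule.mul_le.2 fun m hm b _ => ?_
    have hmr : m ∈ Ring.jacobson A :=
      D.lift_mul_jacobson_le i (mul_le_mul' le_rfl (hspanr i j) hm)
    have hmS : m ∈ S := by
      refine (Submodule.mul_le.2 fun a _ y hy => ?_ :
        D.lift i * Submodule.span k (X i j : Set A) ≤ Subalgebra.toSubmodule S) hm
      rw [mul_eq_of_proj_eq_left (D := D) hr (hσ (D.proj a)).symm (hspanr i j hy)]
      exact S.mul_mem (hσS _) (hspan i j hy)
    rw [mul_eq_of_proj_eq_right (D := D) hr (hσ (D.proj b)).symm hmr]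
    exact S.mul_mem hmS (hσS _)
  refine GenPath.GenPathAlgebra.exists_relations (σ := σ) (x := x) D.proj hσ
    (fun i j β => D.proj_eq_zero_iff.2 (hxr i j β))
    (fun a b ha hb => mul_eq_zero_of_jacobson_sq hr (D.proj_eq_zero_iff.1 ha)
      (D.proj_eq_zero_iff.1 hb)) fun a ha => ?_
  -- Since a lies in r, each Peirce component lies in some ᵢMⱼ, hence in the image.
  have : a = ∑ i, ∑ j, e i * a * e j := by
    simp_rw [← Finset.mul_sum, ← Finset.sum_mul]
    rw [hsum, one_mul, mul_one]
  rw [this]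
  exact sum_mem fun i _ => sum_mem fun j _ => hbi i j
    (Submodule.mul_mem_mul (Submodule.mul_mem_mul (mem_lift_of_proj_eq_single (he i))
      (D.proj_eq_zero_iff.1 ha)) (mem_lift_of_proj_eq_single (he j)))

theorem exists_section (hr : Ring.jacobson A ^ 2 = ⊥)
    (h : Hochschild.dim k (A ⧸ Ring.jacobson A) ≤ 1 ∨
      Hochschild.IsSeparableAlgebra k (A ⧸ Ring.jacobson A) ∨ PerfectField k) :
    ∃ σ : (∀ i, D.comp i) →ₐ[k] A, ∀ b, D.proj (σ b) = b := by
  have key : (∃ σ : (A ⧸ Ring.jacobson A) →ₐ[k] A,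
      ∀ b, Ideal.Quotient.mkₐ k (Ring.jacobson A) (σ b) = b) →
      ∃ σ : (∀ i, D.comp i) →ₐ[k] A, ∀ b, D.proj (σ b) = b := fun ⟨σ, hσ⟩ =>
    ⟨σ.comp D.equiv.symm.toAlgHom, fun b =>
      (congrArg D.equiv (hσ _)).trans (D.equiv.apply_symm_apply b)⟩
  have hker : ∀ x y, Ideal.Quotient.mkₐ k (Ring.jacobson A) x = 0 →
      Ideal.Quotient.mkₐ k (Ring.jacobson A) y = 0 → x * y = 0 := fun x y hx hy =>
    mul_eq_zero_of_jacobson_sq hr (Ideal.Quotient.eq_zero_iff_mem.1 hx)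
      (Ideal.Quotient.eq_zero_iff_mem.1 hy)
  rcases h with h | h | h
  · exact key (Hochschild.exists_algHom_section_of_dim_le_one h _ Ideal.Quotient.mk_surjective
      hker)
  · obtain ⟨e, he⟩ := h.exists_isSeparabilityElement
    exact key (he.exists_algHom_section _ Ideal.Quotient.mk_surjective hker)
  -- Here the separability element belongs to the product of the summands, so the section of
  -- `D.proj` comes directly, without passing through A/r.
  · have hfin : ∀ i, FiniteDimensional k (D.comp i) := fun i =>
      Module.Finite.of_surjective (((Pi.evalAlgHom k D.comp i).comp D.proj).toLinearMap)
        ((Function.surjective_eval i).comp D.proj_surjective)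
    choose e he using fun i => IsSimpleRing.exists_isSeparabilityElement (k := k) (D.comp i)
    obtain ⟨e', he'⟩ := IsSeparabilityElement.exists_pi he
    exact he'.exists_algHom_section D.proj D.proj_surjective fun x y hx hy =>
      mul_eq_zero_of_jacobson_sq hr (D.proj_eq_zero_iff.1 hx) (D.proj_eq_zero_iff.1 hy)

end SimpleDecomposition

theorem mainTheorem6 {k : Type u} [Field k] {A : Type v} [Ring A] [Algebra k A]
    [FiniteDimensional k A] (hr : Ring.jacobson A ^ 2 = ⊥)
    (h : Hochschild.dim k (A ⧸ Ring.jacobson A) ≤ 1 ∨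
      Hochschild.IsSeparableAlgebra k (A ⧸ Ring.jacobson A) ∨ PerfectField k) :
    Nonempty (SimpleDecomposition k (A ⧸ Ring.jacobson A)) ∧
    ∀ D : SimpleDecomposition k (A ⧸ Ring.jacobson A),
      ∃ ρ : Set (GenPath.GenPathAlgebra k D.quiver D.comp),
        (∀ σ ∈ ρ, GenPath.GenPathAlgebra.IsRelation k σ) ∧
        (GenPath.GenPathAlgebra.arrowIdeal k D.quiver D.comp).asIdeal ^ 2 ≤
          (TwoSidedIdeal.span ρ).asIdeal ∧
        TwoSidedIdeal.span ρ ≤ GenPath.GenPathAlgebra.arrowIdeal k D.quiver D.comp ∧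
        Nonempty (A ≃ₐ[k] (TwoSidedIdeal.span ρ).ringCon.Quotient) := by
  -- An Artinian ring is semisimple modulo its radical, so Wedderburn–Artin supplies a
  -- decomposition.
  have : IsArtinianRing A := IsArtinianRing.of_finite k A
  refine ⟨SimpleDecomposition.nonempty_of_isSemisimpleRing _, fun D => ?_⟩
  obtain ⟨σ, hσ⟩ := SimpleDecomposition.exists_section (D := D) hr h
  exact SimpleDecomposition.exists_relations_of_section hr σ hσ
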